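/- Let $f\in C^2(\mathbb R)$, $F(u)=\int_0^u f$, and $V(u;a,c)=F(u)-au-\tfrac c2u^2$. Let $(a_0,E_0,c_0)\in\mathbb R^3$ and suppose that $E_0=V(\cdot;a_0,c_0)$ has simple roots $u_-<u_+$ with $V(u;a_0,c_0)<E_0$ for $u\in(u_-,u_+)$. For $(a,E,c)$ near $(a_0,E_0,c_0)$ let $u_\pm=u_\pm(a,E,c)$ be the continuation of these roots and set $$T(a,E,c)=\sqrt2\int_{u_-}^{u_+}\frac{du}{\sqrt{E-V(u;a,c)}},\qquad M=\int_0^Tu\,dx,\qquad P=\int_0^Tu^2\,dx,$$ where $u=u(\cdot\,;a,E,c)$ is the nonconstant ($T$-periodic) solution of $u_{xxx}+f(u)_x-cu_x=0$ with $\tfrac12u_x^2=E+au+\tfrac c2u^2-F(u)$ and $u(0)=u_-$. It is a stationary solution of $u_t=u_{xxx}+f(u)_x$ in the frame $x+ct$. Write $u_0=u(\cdot\,;a_0,E_0,c_0)$ and $T_0=T(a_0,E_0,c_0)$. Evans function: let $\Phi(x,\mu)$, $\mu\in\mathbb C$, be the matrix solution with $\Phi(0,\mu)=I$ of the first order system for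 $(v,v_x,v_{xx})$ equivalent to $\partial_x(-\partial_x^2-f'(u_0)+c_0)v=\mu v$, and let $D(\mu,\kappa)=\det(\Phi(T_0,\mu)-e^{i\kappa}I)$ for $(\mu,\kappa)\in\mathbb C\times\mathbb R$. Whitham system: let $\omega=1/T$ and regard $T,M,P,\omega$ as functions of $(a,E,s)$ through $c=c_0-s$. The system $\partial_t(M\omega,P\omega,\omega)-\partial_x(a-sM\omega,-sP\omega-2E,-s\omega)=0$ has the characteristic determinant $$\widetilde P(\mu,\kappa;a,E,s)=\det\Big(\mu\,\frac{\partial(M\omega,P\omega,\omega)}{\partial(a,E,s)}-\frac{i\kappa}{T}\,\frac{\partial(a-sM\omega,-sP\omega-2E,-s\omega)}{\partial(a,E,s)}\Big).$$ Theorem. Assume that the Jacobian determinant $\{T,M,P\}_{a,E,c}=\det\frac{\partial(T,M,P)}{\partial(a,E,c)}$ is nonzero at $(a_0,E_0,c_0)$, and that the derivative at $(a_0,E_0,0)$ of the coordinate map $(a,E,s)\mapsto u(\cdot\,;a,E,c_0-s)$ into periodic waves modulo translation is nonsingular, i.e. at that point no nontrivial linear combination of $u_a,u_E,u_s$ is a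 multiple of $u_x$. Then there is a constant $\Gamma_0\neq0$ such that $$D(\mu,\kappa)=\Gamma_0\,\widetilde P(-\mu,\kappa;a_0,E_0,0)+O(|\mu|^4+\kappa^4)\qquad\text{as }(\mu,\kappa)\to(0,0)\text{ in }\mathbb C\times\mathbb R.$$ -/

import Mathlib

open Filter Topology Asymptotics

noncomputable section

namespace GKdV

/-- The Jacobian matrix `∂(G₀, G₁, G₂)/∂(q₀, q₁, q₂)` of first partial derivatives at `q`. -/
def jacobianMatrix (G : (Fin 3 → ℝ) → (Fin 3 → ℝ)) (q : Fin 3 → ℝ) :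
    Matrix (Fin 3) (Fin 3) ℝ :=
  Matrix.of fun i j => deriv (fun t => G (Function.update q j t) i) (q j)

/-- The antiderivative `F` of `f` with `F 0 = 0`. -/
def antideriv (f : ℝ → ℝ) (v : ℝ) : ℝ := ∫ w in (0 : ℝ)..v, f w

/-- The effective potential `V(v; a, c) = F(v) - a v - (c/2) v²`. -/
def potential (f : ℝ → ℝ) (a c v : ℝ) : ℝ := antideriv f v - a * v - c / 2 * v ^ 2

/-- `um < up` are simple roots of `E = V(·; a, c)`, and `V(·; a, c) < E` strictly between them. -/
structure IsPotentialWell (f : ℝ → ℝ) (a E c um up : ℝ) : Prop where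
  lt : um < up
  left_root : potential f a c um = E
  right_root : potential f a c up = E
  left_simple : deriv (potential f a c) um ≠ 0
  right_simple : deriv (potential f a c) up ≠ 0
  below : ∀ v ∈ Set.Ioo um up, potential f a c v < E

/-- The root `u₋(a, E, c)`: left end of the component of `{V(·; a, c) < E}` containing `m`.
The fixed point `m` only selects one potential well. -/
def uMinus (f : ℝ → ℝ) (m a E c : ℝ) : ℝ := sSup {v | v < m ∧ E ≤ potential f a c v}

/-- The root `u₊(a, E, c)`: right end of the component of `{V(·; a, c) < E}` containing `m`. -/
def uPlus (f : ℝ → ℝ) (m a E c : ℝ) : ℝ := sInf {v | m < v ∧ E ≤ potential f a c v}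

/-- The period `T(a, E, c) = √2 ∫_{u₋}^{u₊} dv / √(E - V(v; a, c))`. -/
def period (f : ℝ → ℝ) (m a E c : ℝ) : ℝ :=
  √2 * ∫ v in (uMinus f m a E c)..(uPlus f m a E c), 1 / √(E - potential f a c v)

/-- `u` is the nonconstant solution of the travelling wave equation
`u''' + f(u)' - c u' = 0` with integration constants `a`, `E`, that is
`(u')² / 2 = E + a u + (c/2) u² - F(u)`, normalized by `u(0) = u₋`. -/
structure IsProfile (f : ℝ → ℝ) (m a E c : ℝ) (u : ℝ → ℝ) : Prop where
  contDiff : ContDiff ℝ 3 u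
  travelling : ∀ x, iteratedDeriv 3 u x + deriv (fun y => f (u y)) x - c * deriv u x = 0
  quadrature : ∀ x, (deriv u x) ^ 2 / 2
    = E + a * u x + c / 2 * (u x) ^ 2 - antideriv f (u x)
  init : u 0 = uMinus f m a E c
  nonconstant : ∃ x, u x ≠ u 0

open Classical in
/-- The travelling wave profile `u(·; a, E, c)` (unique when it exists). -/
def profile (f : ℝ → ℝ) (m a E c : ℝ) : ℝ → ℝ :=
  if h : ∃ u, IsProfile f m a E c u then h.choose else 0

/-- The mass `M(a, E, c) = ∫₀ᵀ u dx`. -/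
def mass (f : ℝ → ℝ) (m a E c : ℝ) : ℝ :=
  ∫ x in (0 : ℝ)..(period f m a E c), profile f m a E c x

/-- The momentum `P(a, E, c) = ∫₀ᵀ u² dx`. -/
def momentum (f : ℝ → ℝ) (m a E c : ℝ) : ℝ :=
  ∫ x in (0 : ℝ)..(period f m a E c), (profile f m a E c x) ^ 2

/-- The Jacobian `{T, M, P}_{a,E,c}`. -/
def jacobianTMP (f : ℝ → ℝ) (m a E c : ℝ) : ℝ :=
  (jacobianMatrix (fun q => ![period f m (q 0) (q 1) (q 2), mass f m (q 0) (q 1) (q 2),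
    momentum f m (q 0) (q 1) (q 2)]) ![a, E, c]).det

/-- Nonsingularity at `(a₀, E₀, 0)` of the derivative of the coordinate map
`(a, E, s) ↦ u(·; a, E, c₀ - s)` into periodic waves modulo translation: the tangent space
to the translation orbit is the line spanned by `u_x`, and no nonzero combination of
`u_a, u_E, u_s` lies on it. -/
def CoordinatizationNonsingular (f : ℝ → ℝ) (m a₀ E₀ c₀ : ℝ) : Prop :=
  ∀ α β γ δ : ℝ,
    (∀ x, α * deriv (fun a => profile f m a E₀ c₀ x) a₀
        + β * deriv (fun E => profile f m a₀ E c₀ x) E₀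
        + γ * deriv (fun s => profile f m a₀ E₀ (c₀ - s) x) 0
      = δ * deriv (profile f m a₀ E₀ c₀) x) →
    α = 0 ∧ β = 0 ∧ γ = 0

/-- The coefficient matrix of the first order system for `Y = (v, v_x, v_xx)` equivalent to
`∂ₓ L[u] v = μ v`, `L[u] = -∂ₓ² - f'(u) + c`, that is to
`v''' = (-μ - f''(u) u') v + (c - f'(u)) v'`. -/
def systemMatrix (f : ℝ → ℝ) (c : ℝ) (u : ℝ → ℝ) (μ : ℂ) (x : ℝ) :
    Matrix (Fin 3) (Fin 3) ℂ :=
  !![0, 1, 0;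
     0, 0, 1;
     -μ - ((deriv (deriv f) (u x) * deriv u x : ℝ) : ℂ), ((c - deriv f (u x) : ℝ) : ℂ), 0]

/-- `Φ(x, μ)` is the matrix solution of `Y_x = H(x, μ) Y` with `Φ(0, μ) = I`, for all `μ ∈ ℂ`. -/
def IsFundamentalMatrix (H : ℂ → ℝ → Matrix (Fin 3) (Fin 3) ℂ)
    (Φ : ℝ → ℂ → Matrix (Fin 3) (Fin 3) ℂ) : Prop :=
  ∀ μ, Φ 0 μ = 1 ∧
    ∀ x i j, HasDerivAt (fun y => Φ y μ i j) ((H μ x * Φ x μ) i j) x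

/-- The periodic Evans function `D(μ, κ) = det(Φ(T, μ) - e^{iκ} I)`; `Φ(T, μ)` is the
monodromy matrix. -/
def evansFunction (Φ : ℝ → ℂ → Matrix (Fin 3) (Fin 3) ℂ) (T : ℝ) (μ : ℂ) (κ : ℝ) : ℂ :=
  (Φ T μ - Complex.exp (Complex.I * κ) • (1 : Matrix (Fin 3) (Fin 3) ℂ)).det

/-- The conserved densities `(M ω, P ω, ω)`, `ω = 1/T`, of the Whitham system
`∂ₜ(M ω, P ω, ω) - ∂ₓ(a - s M ω, -s P ω - 2E, -s ω) = 0`, as functions of `q = (a, E, s)`;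
the wave speed parameter is `c = c₀ - s`. -/
def whithamDensity (f : ℝ → ℝ) (m c₀ : ℝ) (q : Fin 3 → ℝ) : Fin 3 → ℝ :=
  let ω := 1 / period f m (q 0) (q 1) (c₀ - q 2)
  ![mass f m (q 0) (q 1) (c₀ - q 2) * ω, momentum f m (q 0) (q 1) (c₀ - q 2) * ω, ω]

/-- The fluxes `(a - s M ω, -s P ω - 2E, -s ω)` of the Whitham system. -/
def whithamFlux (f : ℝ → ℝ) (m c₀ : ℝ) (q : Fin 3 → ℝ) : Fin 3 → ℝ :=
  let ω := 1 / period f m (q 0) (q 1) (c₀ - q 2)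
  ![q 0 - q 2 * mass f m (q 0) (q 1) (c₀ - q 2) * ω,
    -(q 2) * momentum f m (q 0) (q 1) (c₀ - q 2) * ω - 2 * q 1,
    -(q 2) * ω]

/-- The characteristic determinant of the linearized Whitham system,
`P̃(μ, κ; a, E, s) = det(μ ∂(Mω, Pω, ω)/∂(a,E,s)
  - (iκ/T) ∂(a - sMω, -sPω - 2E, -sω)/∂(a,E,s))`. -/
def whithamDet (f : ℝ → ℝ) (m c₀ : ℝ) (μ : ℂ) (κ a E s : ℝ) : ℂ :=
  (μ • (jacobianMatrix (whithamDensity f m c₀) ![a, E, s]).map Complex.ofReal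
    - (Complex.I * κ / (period f m a E (c₀ - s) : ℂ)) •
      (jacobianMatrix (whithamFlux f m c₀) ![a, E, s]).map Complex.ofReal).det

end GKdV

end

/-! Put L = -∂ₓ² - f'(u₀) + c₀. Differentiating the integrated profile equation u'' = a + cu - f(u)
in x and in the parameters gives L u_x = 0, L u_a = -1, L u_E = 0, L u_s = u. Hence u_a and u_E
solve ∂ₓLv = μv up to a residual O(μ), and u_x + μ u_s solves it up to O(μ²).

On exact solutions (Lv)' = μv and (u Lv + u'v' - u''v)' = μuv. Let R consist of these two
functionals and of v', evaluated at 0 or T, where u = u₋, u' = 0, u'' = β ≠ 0; let W hold the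
initial values of the three approximate solutions. Then det(RW) = -β, so D = -det(A)/β with A =
R(Φ(T) - e^{iκ}I)W. The first two rows of A are, to leading order, μ times integrals of v and uv
minus iκ times the initial functionals; the third row contains values such as u_a'(T) = -T_a β,
obtained by differentiating u'(T) = 0. The leading determinant is cubic and the error quartic
(`exists_boundary_estimate`, `evansFunction_expansion`).

Since M_a = ∫u_a + T_a u₋ and P_a = 2∫u u_a + T_a u₋², and likewise for E and s, row operations turn
the cubic into (T⁴/2) P̃(-μ, κ) (`whithamDet_neg`).

The analytic core is `exists_wave_variation`: T, M, P are differentiable with these derivatives. The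
singular quadrature for T is never differentiated. It is identified with twice the first positive
zero of u' for an initial value problem, where Grönwall estimates give derivatives in the parameters
uniformly in x, and T follows by implicit differentiation. -/

namespace GKdV

/-! ### Global existence, uniqueness and Grönwall estimates for ordinary differential equations. -/

section ODE

open scoped Manifold

variable {E : Type*} [NormedAddCommGroup E] [NormedSpace ℝ E]

/-- Makes the uniform-time extension and uniqueness theorems for integral curves on manifolds
available on a vector space. -/
theorem isMIntegralCurveOn_iff_hasDerivAt {X : E → E} {γ : ℝ → E} {s : Set ℝ} (hs : IsOpen s) :
    IsMIntegralCurveOn (I := 𝓘(ℝ, E)) (M := E) γ X s ↔ ∀ t ∈ s, HasDerivAt γ (X (γ t)) t := by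
  refine forall₂_congr fun t ht => ?_
  have : HasMFDerivWithinAt 𝓘(ℝ, ℝ) 𝓘(ℝ, E) γ s t
      ((1 : ℝ →L[ℝ] ℝ).smulRight (X (γ t))) ↔
      HasFDerivWithinAt γ ((1 : ℝ →L[ℝ] ℝ).smulRight (X (γ t))) s t :=
    hasMFDerivWithinAt_iff_hasFDerivWithinAt
  exact this.trans ⟨fun h => h.hasFDerivAt (hs.mem_nhds ht),
    fun h : HasDerivAt γ (X (γ t)) t => h.hasFDerivAt.hasFDerivWithinAt⟩

/-- A `C¹` vector field of linear growth has global integral curves. -/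
theorem exists_forall_hasDerivAt_of_linear_growth [FiniteDimensional ℝ E] {X : E → E} (hX : ContDiff ℝ 1 X) {C : ℝ}
    (hC : ∀ x, ‖X x‖ ≤ C * (1 + ‖x‖)) (x₀ : E) :
    ∃ γ : ℝ → E, γ 0 = x₀ ∧ ∀ t, HasDerivAt γ (X (γ t)) t := by
  have : ProperSpace E := FiniteDimensional.proper ℝ E
  set D : ℝ := max C 1 with hD
  have hD1 : 1 ≤ D := le_max_right _ _
  have hbound : ∀ x, ‖X x‖ ≤ D * (1 + ‖x‖) := fun x =>
    (hC x).trans (mul_le_mul_of_nonneg_right (le_max_left _ _) (by positivity))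
  -- On the ball of radius 1 + ‖x‖ about x the speed is at most 2D(1 + ‖x‖). The quotient 1/(2D) is
  -- an existence time independent of x, so local solutions extend to all times.
  set ε : ℝ := 1 / (2 * D) with hε
  have hε0 : 0 < ε := by positivity
  have hv : ContMDiff 𝓘(ℝ, E) 𝓘(ℝ, E).tangent 1
      (fun x : E => (⟨x, X x⟩ : TangentBundle 𝓘(ℝ, E) E)) :=
    contMDiff_vectorSpace_iff_contDiff.2 hX
  obtain ⟨γ, h0, h⟩ := exists_isMIntegralCurve_of_isMIntegralCurveOn (I := 𝓘(ℝ, E)) (M := E)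
    (v := X) hv hε0 (fun x => by
      set r : NNReal := ⟨1 + ‖x‖, by positivity⟩
      set L : NNReal := ⟨2 * D * (1 + ‖x‖), by positivity⟩
      obtain ⟨K, hK⟩ := (hX.locallyLipschitz.locallyLipschitzOn
        (s := Metric.closedBall x (r : ℝ))).exists_lipschitzOnWith_of_compact
        (isCompact_closedBall x (r : ℝ))
      have hpl : IsPicardLindelof (fun _ => X) (tmin := -ε) (tmax := ε)
          ⟨0, by constructor <;> linarith⟩ x r 0 L K := by
        refine ⟨fun _ _ => hK, fun _ _ => continuousOn_const, fun _ _ y hy => ?_, ?_⟩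
        · have h1 : ‖y‖ ≤ ‖x‖ + (1 + ‖x‖) := by
            have := mem_closedBall_iff_norm.1 hy
            have h2 := norm_le_norm_add_norm_sub' y x
            have h3 : (r : ℝ) = 1 + ‖x‖ := rfl
            linarith
          calc ‖X y‖ ≤ D * (1 + ‖y‖) := hbound y
            _ ≤ D * (2 * (1 + ‖x‖)) := by gcongr; linarith
            _ = L := by change _ = 2 * D * (1 + ‖x‖); ring
        · change 2 * D * (1 + ‖x‖) * max (ε - 0) (0 - -ε) ≤ (1 + ‖x‖) - 0
          rw [sub_zero, zero_sub, neg_neg, max_self, hε]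
          field_simp
          simp
      obtain ⟨γ, h0, h⟩ := hpl.exists_eq_forall_mem_Icc_hasDerivWithinAt₀
      refine ⟨γ, h0, (isMIntegralCurveOn_iff_hasDerivAt isOpen_Ioo).2 fun t ht => ?_⟩
      exact (h t ⟨ht.1.le, ht.2.le⟩).hasDerivAt (Icc_mem_nhds ht.1 ht.2)) x₀
  exact ⟨γ, h0, fun t => (isMIntegralCurveOn_iff_hasDerivAt isOpen_univ).1
    (isMIntegralCurve_iff_isMIntegralCurveOn.1 h) t trivial⟩

/-- Global integral curves of a `C¹` vector field are determined by their initial value. -/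
theorem eq_of_forall_hasDerivAt [CompleteSpace E] {X : E → E} (hX : ContDiff ℝ 1 X)
    {γ γ' : ℝ → E} (hγ : ∀ t, HasDerivAt γ (X (γ t)) t) (hγ' : ∀ t, HasDerivAt γ' (X (γ' t)) t)
    (h0 : γ 0 = γ' 0) : γ = γ' := by
  have hv : ContMDiff 𝓘(ℝ, E) 𝓘(ℝ, E).tangent 1
      (fun x : E => (⟨x, X x⟩ : TangentBundle 𝓘(ℝ, E) E)) :=
    contMDiff_vectorSpace_iff_contDiff.2 hX
  refine isMIntegralCurve_Ioo_eq_of_contMDiff_boundaryless (I := 𝓘(ℝ, E)) (M := E) (v := X)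
    (t₀ := 0) hv ?_ ?_ h0
  · exact isMIntegralCurve_iff_isMIntegralCurveOn.2
      ((isMIntegralCurveOn_iff_hasDerivAt isOpen_univ).2 fun t _ => hγ t)
  · exact isMIntegralCurve_iff_isMIntegralCurveOn.2
      ((isMIntegralCurveOn_iff_hasDerivAt isOpen_univ).2 fun t _ => hγ' t)

/-- A form of Grönwall's inequality with an explicit crude constant. -/
theorem norm_le_mul_exp_of_norm_deriv_le {Z Z' : ℝ → E} {K δ ε L : ℝ} (hK : 1 ≤ K) (hδ : 0 ≤ δ)
    (hε : 0 ≤ ε) (hZ : ∀ x, HasDerivAt Z (Z' x) x) (h0 : ‖Z 0‖ ≤ δ)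
    (hb : ∀ x ∈ Set.Icc 0 L, ‖Z' x‖ ≤ K * ‖Z x‖ + ε) :
    ∀ x ∈ Set.Icc 0 L, ‖Z x‖ ≤ (δ + ε) * Real.exp (K * L) := by
  intro x hx
  have h := norm_le_gronwallBound_of_norm_deriv_right_le (f := Z) (f' := Z') (a := 0) (b := L)
    (fun y _ => (hZ y).continuousAt.continuousWithinAt) (fun y _ => (hZ y).hasDerivWithinAt) h0
    (fun y hy => hb y ⟨hy.1, hy.2.le⟩) x hx
  rw [gronwallBound_of_K_ne_0 (by positivity)] at h
  have h1 : Real.exp (K * (x - 0)) ≤ Real.exp (K * L) := by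
    gcongr; linarith [hx.2]
  have h2 : ε / K ≤ ε := div_le_self hε hK
  have h3 : 1 ≤ Real.exp (K * (x - 0)) := Real.one_le_exp (by
    have := hx.1
    rw [sub_zero]
    positivity)
  have h4 : 0 ≤ ε / K := by positivity
  calc ‖Z x‖ ≤ δ * Real.exp (K * (x - 0)) + ε / K * (Real.exp (K * (x - 0)) - 1) := h
    _ ≤ δ * Real.exp (K * L) + ε * Real.exp (K * L) := by
        gcongr
        linarith
    _ = _ := by ring

end ODE

/-! ### Calculus of parameter derivatives that are uniform in x. -/

/-- `V` is the derivative of `t ↦ U t` at `t = 0`, uniformly on `s`. -/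
def HasUniformDerivOn (U : ℝ → ℝ → ℝ) (V : ℝ → ℝ) (s : Set ℝ) : Prop :=
  ∀ ε > 0, ∀ᶠ t in 𝓝 (0 : ℝ), ∀ x ∈ s, |U t x - U 0 x - t * V x| ≤ ε * |t|

namespace HasUniformDerivOn

variable {U : ℝ → ℝ → ℝ} {V : ℝ → ℝ} {s : Set ℝ}

theorem abs_sub_le (h : HasUniformDerivOn U V s) {B : ℝ} (hB : ∀ x ∈ s, |V x| ≤ B) :
    ∀ᶠ t in 𝓝 (0 : ℝ), ∀ x ∈ s, |U t x - U 0 x| ≤ (1 + B) * |t| := by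
  filter_upwards [h 1 one_pos] with t ht x hx
  have h1 := ht x hx
  have h2 : |t * V x| ≤ |t| * B := by
    rw [abs_mul]
    exact mul_le_mul_of_nonneg_left (hB x hx) (abs_nonneg t)
  have h3 := abs_add_le (U t x - U 0 x - t * V x) (t * V x)
  rw [sub_add_cancel] at h3
  linarith

theorem eventually_abs_sub_le (h : HasUniformDerivOn U V s) {B : ℝ} (hB : ∀ x ∈ s, |V x| ≤ B)
    {ε : ℝ} (hε : 0 < ε) : ∀ᶠ t in 𝓝 (0 : ℝ), ∀ x ∈ s, |U t x - U 0 x| ≤ ε := by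
  have h1 : Tendsto (fun t : ℝ => (1 + B) * |t|) (𝓝 0) (𝓝 0) := by
    have : Continuous fun t : ℝ => (1 + B) * |t| := by fun_prop
    simpa using this.tendsto 0
  filter_upwards [h.abs_sub_le hB, h1.eventually_le_const hε] with t ht ht' x hx
  exact (ht x hx).trans ht'

/-- Implicit differentiation of U_t(y(t)) = 0 for a root already known to be continuous, without
joint differentiability: 0 = U₀(y) + tV(y) + o(t). It serves both for the left root of the potential
and for the period, a zero of the velocity. -/
theorem hasDerivAt_root (h : HasUniformDerivOn U V s) {y : ℝ → ℝ} {y₀ β : ℝ} (hs : s ∈ 𝓝 y₀)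
    (hβ : HasDerivAt (U 0) β y₀) (hβ0 : β ≠ 0) (hV : ContinuousAt V y₀)
    (hy : Tendsto y (𝓝 0) (𝓝 y₀)) (hy0 : y 0 = y₀) (hroot : ∀ᶠ t in 𝓝 (0 : ℝ), U t (y t) = 0) :
    HasDerivAt y (-V y₀ / β) 0 := by
  have hU0 : U 0 y₀ = 0 := hy0 ▸ hroot.self_of_nhds
  have h1 : (fun t => U 0 (y t) - β * (y t - y₀)) =o[𝓝 0] fun t => y t - y₀ := by
    have := (hasDerivAt_iff_isLittleO.1 hβ).comp_tendsto hy
    refine this.congr_left fun t => ?_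
    simp only [Function.comp, hU0, smul_eq_mul]
    ring
  have h2 : (fun t => U 0 (y t) + t * V (y t)) =o[𝓝 0] fun t => t := by
    rw [isLittleO_iff]
    intro ε hε
    filter_upwards [h ε hε, hy hs, hroot] with t ht hts htr
    have := ht (y t) hts
    rw [htr] at this
    rw [Real.norm_eq_abs, Real.norm_eq_abs, ← abs_neg]
    convert! this using 2
    ring
  have h3 : (fun t => t * V (y t) - t * V y₀) =o[𝓝 0] fun t : ℝ => t := by
    have hz : Tendsto (fun t => V (y t) - V y₀) (𝓝 0) (𝓝 0) := by
      simpa using (hV.tendsto.comp hy).sub_const (V y₀)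
    have := (isBigO_refl (fun t : ℝ => t) (𝓝 0)).mul_isLittleO ((isLittleO_one_iff ℝ).2 hz)
    refine (this.congr (fun t => ?_) (fun t => ?_)) <;> ring
  have h1' : (fun t => U 0 (y t) - β * (y t - y₀)) =o[𝓝 0] fun t => β * (y t - y₀) :=
    h1.trans_isBigO ((isBigO_const_mul_self β⁻¹ (fun t => β * (y t - y₀)) (𝓝 0)).congr_left
      fun t => by field_simp)
  -- The error in `h1` is relative to y - y₀. As β ≠ 0 it can be absorbed, which bounds y - y₀ by
  -- O(t) and makes that error o(t).
  have hd : (fun t => y t - y₀) =O[𝓝 0] fun t : ℝ => t := by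
    have h4 : (fun t => β * (y t - y₀)) =O[𝓝 0] fun t : ℝ => t := by
      have h5 := h1'.neg_left.right_isBigO_sub
      refine h5.trans ?_
      have h6 : (fun t => U 0 (y t)) =O[𝓝 0] fun t : ℝ => t := by
        have := (h2.isBigO.sub h3.isBigO).sub
          (isBigO_const_mul_self (V y₀) (fun t : ℝ => t) (𝓝 0))
        exact this.congr_left fun t => by ring
      exact h6.congr_left fun t => by ring
    exact ((isBigO_const_mul_self β⁻¹ (fun t => β * (y t - y₀)) (𝓝 0)).trans h4).congr_left
      fun t => by field_simp
  rw [hasDerivAt_iff_isLittleO, hy0]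
  have h7 := ((h2.sub h3).sub (h1.trans_isBigO hd)).const_mul_left β⁻¹
  have h8 : (fun t : ℝ => t) = fun t => t - 0 := by ext; simp
  rw [← h8]
  refine h7.congr_left fun t => ?_
  simp only [smul_eq_mul]
  field_simp
  ring

theorem sq (h : HasUniformDerivOn U V s) {B : ℝ} (hB : ∀ x ∈ s, |V x| ≤ B)
    (hU : ∀ x ∈ s, |U 0 x| ≤ B) :
    HasUniformDerivOn (fun t x => U t x ^ 2) (fun x => 2 * U 0 x * V x) s := by
  intro ε hε
  have hB0 : 0 ≤ |B| := abs_nonneg B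
  have h1 : Tendsto (fun t : ℝ => (1 + B) ^ 2 * |t|) (𝓝 0) (𝓝 0) := by
    have : Continuous fun t : ℝ => (1 + B) ^ 2 * |t| := by fun_prop
    simpa using this.tendsto 0
  filter_upwards [h.abs_sub_le hB, h (ε / (4 * (1 + |B|))) (by positivity),
    h1.eventually_le_const (half_pos hε)] with t h2 h3 h4 x hx
  have e : U t x ^ 2 - U 0 x ^ 2 - t * (2 * U 0 x * V x)
      = (U t x - U 0 x) ^ 2 + 2 * U 0 x * (U t x - U 0 x - t * V x) := by ring
  rw [e]
  refine (abs_add_le _ _).trans ?_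
  have h5 : |(U t x - U 0 x) ^ 2| ≤ ε / 2 * |t| := by
    rw [abs_pow]
    calc |U t x - U 0 x| ^ 2 ≤ ((1 + B) * |t|) ^ 2 :=
          pow_le_pow_left₀ (abs_nonneg _) (h2 x hx) 2
      _ = ((1 + B) ^ 2 * |t|) * |t| := by ring
      _ ≤ _ := mul_le_mul_of_nonneg_right h4 (abs_nonneg t)
  have h6 : |2 * U 0 x * (U t x - U 0 x - t * V x)| ≤ ε / 2 * |t| := by
    rw [abs_mul, abs_mul, abs_two]
    calc 2 * |U 0 x| * |U t x - U 0 x - t * V x|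
        ≤ 2 * (1 + |B|) * (ε / (4 * (1 + |B|)) * |t|) := by
          gcongr
          · linarith [hU x hx, le_abs_self B]
          · exact h3 x hx
      _ = ε / 2 * |t| := by field_simp; ring
  linarith

/-- The integral splits as ∫₀^{T₀} U_t + ∫_{T₀}^{T(t)} (U_t - U₀) + ∫_{T₀}^{T(t)} U₀. The middle
term is o(T(t) - T₀) by uniform convergence; the others give the two terms of the derivative. -/
theorem hasDerivAt_integral {L : ℝ} (h : HasUniformDerivOn U V (Set.Icc 0 L))
    (hU : ∀ t, Continuous (U t)) (hV : Continuous V) {T : ℝ → ℝ} {T' T₀ : ℝ}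
    (hT : HasDerivAt T T' 0) (hT0 : T 0 = T₀) (hL : T₀ ∈ Set.Ioo 0 L) :
    HasDerivAt (fun t => ∫ x in (0 : ℝ)..(T t), U t x)
      ((∫ x in (0 : ℝ)..T₀, V x) + T' * U 0 T₀) 0 := by
  obtain ⟨B, hB⟩ := isCompact_Icc.exists_bound_of_continuousOn (s := Set.Icc 0 L) hV.continuousOn
  have hi : ∀ t a b, IntervalIntegrable (U t) MeasureTheory.volume a b :=
    fun t a b => (hU t).intervalIntegrable a b
  have hA : HasDerivAt (fun t => ∫ x in (0 : ℝ)..T₀, U t x) (∫ x in (0 : ℝ)..T₀, V x) 0 := by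
    rw [hasDerivAt_iff_isLittleO, isLittleO_iff]
    intro ε hε
    filter_upwards [h (ε / T₀) (div_pos hε hL.1)] with t ht
    rw [smul_eq_mul, ← intervalIntegral.integral_sub (hi _ _ _) (hi _ _ _), sub_zero,
      ← intervalIntegral.integral_const_mul, ← intervalIntegral.integral_sub
        ((hi _ _ _).sub (hi _ _ _)) ((hV.const_mul t).intervalIntegrable _ _)]
    refine (intervalIntegral.norm_integral_le_of_norm_le_const (C := ε / T₀ * |t|)
      fun x hx => ?_).trans ?_
    · rw [Set.uIoc_of_le hL.1.le] at hx
      exact ht x ⟨hx.1.le, hx.2.trans hL.2.le⟩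
    · rw [sub_zero, abs_of_pos hL.1, Real.norm_eq_abs]
      have := hL.1.ne'
      apply le_of_eq
      field_simp
  have hmem : ∀ᶠ t in 𝓝 (0 : ℝ), T t ∈ Set.Ioo 0 L := by
    have := hT.continuousAt.tendsto
    rw [hT0] at this
    exact this (Ioo_mem_nhds hL.1 hL.2)
  have hTO : (fun t => T t - T₀) =O[𝓝 0] fun t : ℝ => t := by
    have := hT.isBigO_sub
    rw [hT0] at this
    simpa using this
  have hB' : HasDerivAt (fun t => ∫ x in T₀..(T t), (U t x - U 0 x)) 0 0 := by
    rw [hasDerivAt_iff_isLittleO, hT0]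
    have : (fun t => ∫ x in T₀..(T t), (U t x - U 0 x)) =o[𝓝 0] fun t => T t - T₀ := by
      rw [isLittleO_iff]
      intro ε hε
      filter_upwards [h.eventually_abs_sub_le hB hε, hmem] with t ht hm
      refine intervalIntegral.norm_integral_le_of_norm_le_const fun x hx => ht x ?_
      have := Set.uIoc_subset_uIcc hx
      exact ⟨(le_min hL.1.le hm.1.le).trans this.1, this.2.trans (max_le hL.2.le hm.2.le)⟩
    simpa using this.trans_isBigO hTO
  have hC : HasDerivAt (fun t => ∫ x in T₀..(T t), U 0 x) (U 0 T₀ * T') 0 := by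
    have h1 : HasDerivAt (fun y => ∫ x in T₀..y, U 0 x) (U 0 T₀) (T 0) := by
      rw [hT0]
      exact intervalIntegral.integral_hasDerivAt_right (hi _ _ _)
        ((hU 0).stronglyMeasurableAtFilter _ _) (hU 0).continuousAt
    exact h1.comp 0 hT
  refine ((hA.add hB').add hC).congr_deriv (by ring) |>.congr_of_eventuallyEq
    (Eventually.of_forall fun t => ?_)
  simp only [Pi.add_apply]
  rw [intervalIntegral.integral_sub (hi _ _ _) (hi _ _ _), add_assoc, sub_add_cancel,
    intervalIntegral.integral_add_adjacent_intervals (hi _ _ _) (hi _ _ _)]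

end HasUniformDerivOn

/-! ### The profile equation with a bounded nonlinearity, its symmetries and its dependence on
parameters. -/

/-- `g` is of class `C²` and is bounded by `K` together with its first two derivatives. -/
structure IsTame (g : ℝ → ℝ) (K : ℝ) : Prop where
  contDiff : ContDiff ℝ 2 g
  abs_le : ∀ x, |g x| ≤ K
  abs_deriv_le : ∀ x, |deriv g x| ≤ K
  abs_deriv_deriv_le : ∀ x, |deriv (deriv g) x| ≤ K

theorem contDiff_one_deriv {g : ℝ → ℝ} (hg : ContDiff ℝ 2 g) : ContDiff ℝ 1 (deriv g) :=
  ((contDiff_succ_iff_deriv (n := 1)).1 hg).2.2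

namespace IsTame

variable {g : ℝ → ℝ} {K : ℝ}

theorem nonneg (h : IsTame g K) : 0 ≤ K := (abs_nonneg _).trans (h.abs_le 0)

theorem hasDerivAt (h : IsTame g K) (x : ℝ) : HasDerivAt g (deriv g x) x :=
  (h.contDiff.differentiable (by norm_num) x).hasDerivAt

theorem hasDerivAt_deriv (h : IsTame g K) (x : ℝ) :
    HasDerivAt (deriv g) (deriv (deriv g) x) x :=
  ((contDiff_one_deriv h.contDiff).differentiable (by norm_num) x).hasDerivAt

theorem abs_sub_le (h : IsTame g K) (x y : ℝ) : |g y - g x| ≤ K * |y - x| :=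
  convex_univ.norm_image_sub_le_of_norm_hasDerivWithin_le
    (fun z _ => (h.hasDerivAt z).hasDerivWithinAt) (fun z _ => h.abs_deriv_le z) trivial trivial

theorem abs_deriv_sub_le (h : IsTame g K) (x y : ℝ) :
    |deriv g y - deriv g x| ≤ K * |y - x| :=
  convex_univ.norm_image_sub_le_of_norm_hasDerivWithin_le
    (fun z _ => (h.hasDerivAt_deriv z).hasDerivWithinAt) (fun z _ => h.abs_deriv_deriv_le z)
    trivial trivial

theorem abs_taylor_le (h : IsTame g K) (x y : ℝ) :
    |g y - g x - deriv g x * (y - x)| ≤ K * (y - x) ^ 2 := by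
  have h1 := (convex_uIcc x y).norm_image_sub_le_of_norm_hasDerivWithin_le
    (f := fun z => g z - deriv g x * z) (f' := fun z => deriv g z - deriv g x)
    (C := K * |y - x|)
    (fun z _ => ((h.hasDerivAt z).sub (((hasDerivAt_id z).const_mul (deriv g x)).congr_deriv
      (mul_one _))).hasDerivWithinAt)
    (fun z hz => (h.abs_deriv_sub_le x z).trans (mul_le_mul_of_nonneg_left
      (Set.abs_sub_left_of_mem_uIcc hz) h.nonneg))
    Set.left_mem_uIcc Set.right_mem_uIcc
  calc |g y - g x - deriv g x * (y - x)| = ‖g y - deriv g x * y - (g x - deriv g x * x)‖ := by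
        rw [Real.norm_eq_abs]; ring_nf
    _ ≤ K * |y - x| * ‖y - x‖ := h1
    _ = K * (y - x) ^ 2 := by rw [Real.norm_eq_abs, mul_assoc, abs_mul_abs_self]; ring

end IsTame

/-- `u` solves `u'' = a + c u - g(u)`, `u(0) = b`, `u'(0) = 0`, with derivative `p`. -/
structure IsNewton (g : ℝ → ℝ) (a c b : ℝ) (u p : ℝ → ℝ) : Prop where
  du : ∀ x, HasDerivAt u (p x) x
  dp : ∀ x, HasDerivAt p (a + c * u x - g (u x)) x
  u0 : u 0 = b
  p0 : p 0 = 0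

/-- `v` solves the linearized equation `v'' = α + γ u + (c - g'(u)) v`, with derivative `r`. -/
structure IsVariation (g : ℝ → ℝ) (c α γ : ℝ) (u v r : ℝ → ℝ) : Prop where
  dv : ∀ x, HasDerivAt v (r x) x
  dr : ∀ x, HasDerivAt r (α + γ * u x + (c - deriv g (u x)) * v x) x
  r0 : r 0 = 0

/-- The equation and its linearization form one autonomous field on ℝ⁴. It is C¹ because g is C²,
and of linear growth because g and g' are bounded. -/
theorem exists_newton_variation {g : ℝ → ℝ} {K : ℝ} (hg : IsTame g K) (a c b α γ v₀ : ℝ) :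
    ∃ u p v r, IsNewton g a c b u p ∧ IsVariation g c α γ u v r ∧ v 0 = v₀ := by
  have hg1 := contDiff_one_deriv hg.contDiff
  have hg0 : ContDiff ℝ 1 g := hg.contDiff.of_le (by norm_num)
  have hK := hg.nonneg
  let X : ℝ × ℝ × ℝ × ℝ → ℝ × ℝ × ℝ × ℝ := fun z =>
    (z.2.1, a + c * z.1 - g z.1, z.2.2.2, α + γ * z.1 + (c - deriv g z.1) * z.2.2.1)
  have hX : ContDiff ℝ 1 X := by
    have := hg0.comp (contDiff_fst : ContDiff ℝ 1 fun z : ℝ × ℝ × ℝ × ℝ => z.1)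
    have := hg1.comp (contDiff_fst : ContDiff ℝ 1 fun z : ℝ × ℝ × ℝ × ℝ => z.1)
    simp only [Function.comp_def] at *
    fun_prop
  have hC : ∀ z, ‖X z‖ ≤ (1 + |a| + |c| + K + |α| + |γ|) * (1 + ‖z‖) := by
    rintro ⟨u, p, v, r⟩
    set N := ‖((u, p, v, r) : ℝ × ℝ × ℝ × ℝ)‖ with hN
    have hNe : N = max |u| (max |p| (max |v| |r|)) := by simp [hN, Prod.norm_def]
    have h0 : 0 ≤ N := norm_nonneg _
    have hu : |u| ≤ N := by rw [hNe]; exact le_max_left _ _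
    have hp : |p| ≤ N := by rw [hNe]; exact (le_max_left _ _).trans (le_max_right _ _)
    have hv : |v| ≤ N := by
      rw [hNe]; exact ((le_max_left _ _).trans (le_max_right _ _)).trans (le_max_right _ _)
    have hr : |r| ≤ N := by
      rw [hNe]; exact ((le_max_right _ _).trans (le_max_right _ _)).trans (le_max_right _ _)
    have ha := abs_nonneg a
    have hc := abs_nonneg c
    have hα := abs_nonneg α
    have hγ := abs_nonneg γ
    have e1 : |a + c * u - g u| ≤ |a| + |c| * N + K := by
      refine (abs_sub _ _).trans (add_le_add ((abs_add_le _ _).trans ?_) (hg.abs_le u))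
      rw [abs_mul]
      gcongr
    have e2 : |α + γ * u + (c - deriv g u) * v| ≤ |α| + |γ| * N + (|c| + K) * N := by
      refine (abs_add_le _ _).trans (add_le_add ((abs_add_le _ _).trans ?_) ?_)
      · rw [abs_mul]
        gcongr
      · rw [abs_mul]
        gcongr
        exact (abs_sub _ _).trans (add_le_add le_rfl (hg.abs_deriv_le u))
    simp only [X, Prod.norm_def, Real.norm_eq_abs]
    refine max_le ?_ (max_le ?_ (max_le ?_ ?_)) <;>
      nlinarith [mul_nonneg ha h0, mul_nonneg hc h0, mul_nonneg hα h0, mul_nonneg hγ h0,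
        mul_nonneg hK h0]
  obtain ⟨z, hz0, hz⟩ := exists_forall_hasDerivAt_of_linear_growth hX hC (b, 0, v₀, 0)
  refine ⟨fun x => (z x).1, fun x => (z x).2.1, fun x => (z x).2.2.1, fun x => (z x).2.2.2,
    ⟨fun x => (hz x).fst, fun x => (hz x).snd.fst, by simp [hz0], by simp [hz0]⟩,
    ⟨fun x => (hz x).snd.snd.fst, fun x => (hz x).snd.snd.snd, by simp [hz0]⟩, by simp [hz0]⟩

namespace IsNewton

variable {g : ℝ → ℝ} {a c b : ℝ} {u p : ℝ → ℝ}

theorem continuous_u (h : IsNewton g a c b u p) : Continuous u :=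
  continuous_iff_continuousAt.2 fun x => (h.du x).continuousAt

theorem continuous_p (h : IsNewton g a c b u p) : Continuous p :=
  continuous_iff_continuousAt.2 fun x => (h.dp x).continuousAt

theorem eq_of_initial (hg : ContDiff ℝ 1 g) {u₁ p₁ u₂ p₂ : ℝ → ℝ}
    (d₁ : ∀ x, HasDerivAt u₁ (p₁ x) x) (e₁ : ∀ x, HasDerivAt p₁ (a + c * u₁ x - g (u₁ x)) x)
    (d₂ : ∀ x, HasDerivAt u₂ (p₂ x) x) (e₂ : ∀ x, HasDerivAt p₂ (a + c * u₂ x - g (u₂ x)) x)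
    (hu : u₁ 0 = u₂ 0) (hp : p₁ 0 = p₂ 0) : u₁ = u₂ ∧ p₁ = p₂ := by
  let X : ℝ × ℝ → ℝ × ℝ := fun z => (z.2, a + c * z.1 - g z.1)
  have hX : ContDiff ℝ 1 X := by
    have := hg.comp (contDiff_fst : ContDiff ℝ 1 fun z : ℝ × ℝ => z.1)
    simp only [Function.comp_def] at *
    fun_prop
  have := eq_of_forall_hasDerivAt hX (γ := fun x => (u₁ x, p₁ x)) (γ' := fun x => (u₂ x, p₂ x))
    (fun x => (d₁ x).prodMk (e₁ x)) (fun x => (d₂ x).prodMk (e₂ x)) (by simp [hu, hp])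
  exact ⟨funext fun x => congrArg Prod.fst (congrFun this x),
    funext fun x => congrArg Prod.snd (congrFun this x)⟩

/-- Solutions are symmetric about critical points. -/
theorem reflect (hg : ContDiff ℝ 1 g) (h : IsNewton g a c b u p) {τ : ℝ} (hτ : p τ = 0) (x : ℝ) :
    u (τ - x) = u (τ + x) ∧ -p (τ - x) = p (τ + x) := by
  have d1 : ∀ x : ℝ, HasDerivAt (fun y => τ - y) (-1) x := fun x => by
    simpa using (hasDerivAt_id x).const_sub τ
  have d2 : ∀ x : ℝ, HasDerivAt (fun y => τ + y) 1 x := fun x => by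
    simpa using (hasDerivAt_id x).const_add τ
  have := eq_of_initial hg (u₁ := fun y => u (τ - y)) (p₁ := fun y => -p (τ - y))
    (u₂ := fun y => u (τ + y)) (p₂ := fun y => p (τ + y)) (a := a) (c := c)
    (fun x => ((h.du _).comp x (d1 x)).congr_deriv (by ring))
    (fun x => ((h.dp _).comp x (d1 x)).neg.congr_deriv (by ring))
    (fun x => ((h.du _).comp x (d2 x)).congr_deriv (by ring))
    (fun x => ((h.dp _).comp x (d2 x)).congr_deriv (by ring)) (by simp) (by simp [hτ])
  exact ⟨congrFun this.1 x, congrFun this.2 x⟩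

theorem even (hg : ContDiff ℝ 1 g) (h : IsNewton g a c b u p) (x : ℝ) :
    u (-x) = u x ∧ -p (-x) = p x := by
  simpa using h.reflect hg h.p0 x

theorem periodic (hg : ContDiff ℝ 1 g) (h : IsNewton g a c b u p) {τ : ℝ} (hτ : p τ = 0) :
    Function.Periodic u (2 * τ) ∧ Function.Periodic p (2 * τ) := by
  have h1 := fun x => h.reflect hg hτ (τ + x)
  have h2 := h.even hg
  refine ⟨fun x => ?_, fun x => ?_⟩
  · have := (h1 x).1
    rw [show τ - (τ + x) = -x by ring, (h2 x).1, show τ + (τ + x) = x + 2 * τ by ring] at this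
    exact this.symm
  · have := (h1 x).2
    rw [show τ - (τ + x) = -x by ring, (h2 x).2, show τ + (τ + x) = x + 2 * τ by ring] at this
    exact this.symm

/-- Conservation of energy. -/
theorem energy {G : ℝ → ℝ} (hG : ∀ x, HasDerivAt G (g x) x) (h : IsNewton g a c b u p) (x : ℝ) :
    p x ^ 2 / 2 + (G (u x) - a * u x - c / 2 * u x ^ 2) = G b - a * b - c / 2 * b ^ 2 := by
  have hd : ∀ x, HasDerivAt
      (fun x => p x ^ 2 / 2 + (G (u x) - a * u x - c / 2 * u x ^ 2)) 0 x := fun x => by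
    have h1 := (((h.dp x).pow 2).div_const 2).add
      ((((hG (u x)).comp x (h.du x)).sub ((h.du x).const_mul a)).sub
        (((h.du x).pow 2).const_mul (c / 2)))
    refine h1.congr_deriv ?_
    push_cast
    ring
  have := is_const_of_deriv_eq_zero (fun x => (hd x).differentiableAt) (fun x => (hd x).deriv) x 0
  rw [this, h.u0, h.p0]
  ring

/-- Lipschitz dependence of solutions on a parameter. -/
theorem eventually_norm_sub_le {K : ℝ} (hg : IsTame g K) {α γ b' : ℝ} {bt : ℝ → ℝ}
    {U P : ℝ → ℝ → ℝ} (h : ∀ t, IsNewton g (a + t * α) (c + t * γ) (bt t) (U t) (P t))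
    (hb : HasDerivAt bt b' 0) (L : ℝ) :
    ∃ C, ∀ᶠ t in 𝓝 (0 : ℝ), ∀ x ∈ Set.Icc 0 L, ‖(U t x - U 0 x, P t x - P 0 x)‖ ≤ C * |t| := by
  obtain ⟨B, hB⟩ := isCompact_Icc.exists_bound_of_continuousOn (s := Set.Icc 0 L)
    (h 0).continuous_u.continuousOn
  have hB' : ∀ x ∈ Set.Icc 0 L, |U 0 x| ≤ |B| := fun x hx => (hB x hx).trans (le_abs_self B)
  have hK := hg.nonneg
  refine ⟨((|b'| + 1) + (|α| + |γ| * |B|)) * Real.exp ((1 + |c| + |γ| + K) * L), ?_⟩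
  have hlip : ∀ᶠ t in 𝓝 (0 : ℝ), |bt t - bt 0| ≤ (|b'| + 1) * |t| := by
    have := (hasDerivAt_iff_isLittleO.1 hb).def one_pos
    filter_upwards [this] with t ht
    have h2 := abs_add_le (bt t - bt 0 - (t - 0) • b') (t * b')
    simp only [sub_zero, smul_eq_mul, sub_add_cancel, one_mul, Real.norm_eq_abs, abs_mul]
      at h2 ht
    linarith
  filter_upwards [hlip, Icc_mem_nhds (show (-1 : ℝ) < 0 by norm_num) one_pos] with t ht ht1 x hx
  have ht1' : |t| ≤ 1 := abs_le.2 ht1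
  have key := norm_le_mul_exp_of_norm_deriv_le
    (Z := fun x => (U t x - U 0 x, P t x - P 0 x))
    (Z' := fun x => (P t x - P 0 x, (a + t * α + (c + t * γ) * U t x - g (U t x))
      - (a + 0 * α + (c + 0 * γ) * U 0 x - g (U 0 x))))
    (K := 1 + |c| + |γ| + K) (δ := (|b'| + 1) * |t|) (ε := |t| * (|α| + |γ| * |B|)) (L := L)
    (by have := abs_nonneg c; have := abs_nonneg γ; linarith) (by positivity) (by positivity)
    (fun x => (((h t).du x).sub ((h 0).du x)).prodMk (((h t).dp x).sub ((h 0).dp x)))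
    (by
      simp only [(h t).u0, (h 0).u0, (h t).p0, (h 0).p0, sub_self, Prod.norm_def, norm_zero]
      exact max_le ht (by positivity))
    (fun x hx => by
      set N := ‖(U t x - U 0 x, P t x - P 0 x)‖ with hN
      have h0 : 0 ≤ N := norm_nonneg _
      have hu : |U t x - U 0 x| ≤ N := by
        rw [hN, Prod.norm_def]; exact le_max_left _ _
      have hp : |P t x - P 0 x| ≤ N := by
        rw [hN, Prod.norm_def]; exact le_max_right _ _
      have hrhs : 0 ≤ |t| * (|α| + |γ| * |B|) := by positivity
      have hc := mul_nonneg (abs_nonneg c) h0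
      have hγ := mul_nonneg (abs_nonneg γ) h0
      have hKN := mul_nonneg hK h0
      rw [Prod.norm_def]
      refine max_le ?_ ?_
      · rw [Real.norm_eq_abs]
        nlinarith
      · rw [Real.norm_eq_abs, show (a + t * α + (c + t * γ) * U t x - g (U t x))
          - (a + 0 * α + (c + 0 * γ) * U 0 x - g (U 0 x))
          = t * (α + γ * U 0 x) + (c + t * γ) * (U t x - U 0 x) - (g (U t x) - g (U 0 x)) by ring]
        have e1 : |t * (α + γ * U 0 x)| ≤ |t| * (|α| + |γ| * |B|) := by
          rw [abs_mul]
          refine mul_le_mul_of_nonneg_left ((abs_add_le _ _).trans ?_) (abs_nonneg t)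
          rw [abs_mul]
          exact add_le_add le_rfl (mul_le_mul_of_nonneg_left (hB' x hx) (abs_nonneg γ))
        have e2 : |(c + t * γ) * (U t x - U 0 x)| ≤ (|c| + |γ|) * N := by
          rw [abs_mul]
          gcongr
          refine (abs_add_le _ _).trans ?_
          rw [abs_mul]
          have := mul_le_mul_of_nonneg_right ht1' (abs_nonneg γ)
          linarith
        have e3 : |g (U t x) - g (U 0 x)| ≤ K * N :=
          (hg.abs_sub_le _ _).trans (mul_le_mul_of_nonneg_left hu hK)
        have e4 := abs_sub (t * (α + γ * U 0 x) + (c + t * γ) * (U t x - U 0 x))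
          (g (U t x) - g (U 0 x))
        have e5 := abs_add_le (t * (α + γ * U 0 x)) ((c + t * γ) * (U t x - U 0 x))
        nlinarith) x hx
  refine key.trans (le_of_eq ?_)
  ring

/-- Differentiable dependence of solutions on a parameter, with the solution of the linearized
equation as derivative. -/
theorem hasUniformDerivOn {K : ℝ} (hg : IsTame g K) {α γ b' : ℝ} {bt : ℝ → ℝ}
    {U P : ℝ → ℝ → ℝ} (h : ∀ t, IsNewton g (a + t * α) (c + t * γ) (bt t) (U t) (P t))
    (hb : HasDerivAt bt b' 0) {v r : ℝ → ℝ} (hv : IsVariation g c α γ (U 0) v r) (hv0 : v 0 = b')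
    (L : ℝ) :
    HasUniformDerivOn U v (Set.Icc 0 L) ∧ HasUniformDerivOn P r (Set.Icc 0 L) := by
  obtain ⟨C, hC⟩ := eventually_norm_sub_le hg h hb L
  have hK := hg.nonneg
  set Q := Real.exp ((1 + |c| + K) * L)
  set R := |γ| * |C| + K * C ^ 2
  -- The remainder U_t - U₀ - tv solves the linearized equation with forcing tγ(U_t - U₀) minus a
  -- Taylor remainder of g. Both are O(t²) by the Lipschitz bound, and the initial error is o(t), so
  -- Grönwall applies.
  have hmain : ∀ᶠ t in 𝓝 (0 : ℝ), ∀ x ∈ Set.Icc 0 L,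
      ‖(U t x - U 0 x - t * v x, P t x - P 0 x - t * r x)‖
        ≤ (|bt t - bt 0 - t * b'| + R * |t| ^ 2) * Q := by
    filter_upwards [hC] with t ht x hx
    refine norm_le_mul_exp_of_norm_deriv_le
      (Z := fun x => (U t x - U 0 x - t * v x, P t x - P 0 x - t * r x))
      (Z' := fun x => (P t x - P 0 x - t * r x,
        (a + t * α + (c + t * γ) * U t x - g (U t x))
        - (a + 0 * α + (c + 0 * γ) * U 0 x - g (U 0 x))
        - t * (α + γ * U 0 x + (c - deriv g (U 0 x)) * v x)))
      (by have := abs_nonneg c; linarith) (abs_nonneg _) (by positivity)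
      (fun x => ((((h t).du x).sub ((h 0).du x)).sub ((hv.dv x).const_mul t)).prodMk
        ((((h t).dp x).sub ((h 0).dp x)).sub ((hv.dr x).const_mul t)))
      (by
        simp only [(h t).u0, (h 0).u0, (h t).p0, (h 0).p0, sub_self, Prod.norm_def, hv0, hv.r0,
          mul_zero, norm_zero]
        exact max_le le_rfl (abs_nonneg _))
      (fun x hx => ?_) x hx
    set N := ‖(U t x - U 0 x - t * v x, P t x - P 0 x - t * r x)‖ with hN
    have h0 : 0 ≤ N := norm_nonneg _
    have hu : |U t x - U 0 x - t * v x| ≤ N := by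
      rw [hN, Prod.norm_def]; exact le_max_left _ _
    have hp : |P t x - P 0 x - t * r x| ≤ N := by
      rw [hN, Prod.norm_def]; exact le_max_right _ _
    have hC' : |U t x - U 0 x| ≤ |C| * |t| :=
      ((le_max_left _ _).trans (ht x hx)).trans
        (mul_le_mul_of_nonneg_right (le_abs_self C) (abs_nonneg t))
    have hR : 0 ≤ R * |t| ^ 2 := by positivity
    have hc := mul_nonneg (abs_nonneg c) h0
    have hKN := mul_nonneg hK h0
    rw [Prod.norm_def]
    refine max_le ?_ ?_
    · rw [Real.norm_eq_abs]
      nlinarith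
    · rw [Real.norm_eq_abs, show (a + t * α + (c + t * γ) * U t x - g (U t x))
        - (a + 0 * α + (c + 0 * γ) * U 0 x - g (U 0 x))
        - t * (α + γ * U 0 x + (c - deriv g (U 0 x)) * v x)
        = (c - deriv g (U 0 x)) * (U t x - U 0 x - t * v x) + t * γ * (U t x - U 0 x)
          - (g (U t x) - g (U 0 x) - deriv g (U 0 x) * (U t x - U 0 x)) by ring]
      have e1 : |(c - deriv g (U 0 x)) * (U t x - U 0 x - t * v x)| ≤ (|c| + K) * N := by
        rw [abs_mul]
        gcongr
        exact (abs_sub _ _).trans (add_le_add le_rfl (hg.abs_deriv_le _))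
      have e2 : |t * γ * (U t x - U 0 x)| ≤ |γ| * |C| * |t| ^ 2 := by
        rw [abs_mul, abs_mul]
        have := mul_le_mul_of_nonneg_left hC' (mul_nonneg (abs_nonneg t) (abs_nonneg γ))
        linarith
      have e3 : |g (U t x) - g (U 0 x) - deriv g (U 0 x) * (U t x - U 0 x)|
          ≤ K * C ^ 2 * |t| ^ 2 := by
        refine (hg.abs_taylor_le _ _).trans ?_
        rw [mul_assoc, ← sq_abs (U t x - U 0 x), ← sq_abs C, ← mul_pow]
        gcongr
      have e4 := abs_sub ((c - deriv g (U 0 x)) * (U t x - U 0 x - t * v x)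
        + t * γ * (U t x - U 0 x))
        (g (U t x) - g (U 0 x) - deriv g (U 0 x) * (U t x - U 0 x))
      have e5 := abs_add_le ((c - deriv g (U 0 x)) * (U t x - U 0 x - t * v x))
        (t * γ * (U t x - U 0 x))
      have e6 : R * |t| ^ 2 = |γ| * |C| * |t| ^ 2 + K * C ^ 2 * |t| ^ 2 := by
        simp only [R]; ring
      nlinarith
  have hQ : 0 < Q := Real.exp_pos _
  have hsmall : ∀ ε > 0, ∀ᶠ t in 𝓝 (0 : ℝ),
      (|bt t - bt 0 - t * b'| + R * |t| ^ 2) * Q ≤ ε * |t| := by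
    intro ε hε
    have h1 := (hasDerivAt_iff_isLittleO.1 hb).def (show 0 < ε / (2 * Q) by positivity)
    have h2 : Tendsto (fun t : ℝ => R * |t| * Q) (𝓝 0) (𝓝 0) := by
      have : Continuous fun t : ℝ => R * |t| * Q := by fun_prop
      simpa using this.tendsto 0
    filter_upwards [h1, h2.eventually_le_const (half_pos hε)] with t h3 h4
    simp only [sub_zero, smul_eq_mul, Real.norm_eq_abs] at h3
    calc (|bt t - bt 0 - t * b'| + R * |t| ^ 2) * Q
        = |bt t - bt 0 - t * b'| * Q + (R * |t| * Q) * |t| := by ring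
      _ ≤ ε / (2 * Q) * |t| * Q + ε / 2 * |t| := by gcongr
      _ = ε * |t| := by field_simp; ring
  constructor
  · intro ε hε
    filter_upwards [hmain, hsmall ε hε] with t h1 h2 x hx
    exact (le_max_left _ _).trans ((h1 x hx).trans h2)
  · intro ε hε
    filter_upwards [hmain, hsmall ε hε] with t h1 h2 x hx
    exact (le_max_right _ _).trans ((h1 x hx).trans h2)

end IsNewton

/-! ### Motion in a potential well: the first turning point and its persistence. -/

theorem hasDerivAt_antideriv {g : ℝ → ℝ} (hg : Continuous g) (x : ℝ) :
    HasDerivAt (antideriv g) (g x) x :=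
  intervalIntegral.integral_hasDerivAt_right (hg.intervalIntegrable _ _)
    (hg.stronglyMeasurableAtFilter _ _) hg.continuousAt

theorem hasDerivAt_potential {g : ℝ → ℝ} (hg : Continuous g) (a c x : ℝ) :
    HasDerivAt (potential g a c) (g x - a - c * x) x := by
  have := ((hasDerivAt_antideriv hg x).sub ((hasDerivAt_id x).const_mul a)).sub
    (((hasDerivAt_id x).pow 2).const_mul (c / 2))
  refine this.congr_deriv ?_
  simp
  ring

theorem IsNewton.energy_eq {g : ℝ → ℝ} (hg : Continuous g) {a c b : ℝ} {u p : ℝ → ℝ}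
    (h : IsNewton g a c b u p) (x : ℝ) :
    p x ^ 2 / 2 + potential g a c (u x) = potential g a c b :=
  h.energy (hasDerivAt_antideriv hg) x

namespace IsPotentialWell

variable {g : ℝ → ℝ} {a E c um up : ℝ}

theorem left_deriv_neg (hg : Continuous g) (h : IsPotentialWell g a E c um up) :
    g um - a - c * um < 0 := by
  have hd := hasDerivAt_potential hg a c um
  have h1 := h.left_simple
  rw [hd.deriv] at h1
  refine lt_of_le_of_ne (le_of_tendsto ((hasDerivAt_iff_tendsto_slope.1 hd).mono_left
    (nhdsWithin_mono um fun x (hx : x ∈ Set.Ioi um) => ne_of_gt hx)) ?_) h1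
  filter_upwards [Ioo_mem_nhdsGT h.lt] with x hx
  rw [slope_def_field, h.left_root]
  exact div_nonpos_of_nonpos_of_nonneg (by linarith [h.below x hx]) (by linarith [hx.1])

theorem right_deriv_pos (hg : Continuous g) (h : IsPotentialWell g a E c um up) :
    0 < g up - a - c * up := by
  have hd := hasDerivAt_potential hg a c up
  have h1 := h.right_simple
  rw [hd.deriv] at h1
  refine lt_of_le_of_ne (ge_of_tendsto ((hasDerivAt_iff_tendsto_slope.1 hd).mono_left
    (nhdsWithin_mono up fun x (hx : x ∈ Set.Iio up) => ne_of_lt hx)) ?_) h1.symm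
  filter_upwards [Ioo_mem_nhdsLT h.lt] with x hx
  rw [slope_def_field, h.right_root]
  exact div_nonneg_of_nonpos (by linarith [h.below x hx]) (by linarith [hx.2])

end IsPotentialWell

theorem eventually_pos_right_of_hasDerivAt {p : ℝ → ℝ} {β : ℝ} (hp : HasDerivAt p β 0)
    (h0 : p 0 = 0) (hβ : 0 < β) : ∀ᶠ x in 𝓝[>] (0 : ℝ), 0 < p x := by
  have := ((hasDerivAt_iff_tendsto_slope.1 hp).mono_left
    (nhdsWithin_mono 0 fun x (hx : x ∈ Set.Ioi (0 : ℝ)) => ne_of_gt hx)).eventually_const_lt hβ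
  filter_upwards [this, self_mem_nhdsWithin] with x hx hx0
  rw [slope_def_field, h0, sub_zero, sub_zero] at hx
  exact (div_pos_iff_of_pos_right hx0).1 hx

/-- A solution starting at the left end of a potential well turns around in finite time. -/
theorem IsNewton.exists_turning_point {g : ℝ → ℝ} (hg : Continuous g) {a E c um up : ℝ}
    (hw : IsPotentialWell g a E c um up) {u p : ℝ → ℝ} (h : IsNewton g a c um u p) :
    ∃ x > 0, p x ≤ 0 := by
  -- If p stayed positive, u would increase without reaching `up`. Either u comes close to `up`,
  -- where p' ≤ -d/2 forces p to vanish in finite time, or u stays away from `up`; then energy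
  -- bounds p below and u crosses `up` in finite time.
  by_contra! hpos
  have hen := fun x => h.energy_eq hg x
  rw [hw.left_root] at hen
  have hmono : StrictMonoOn u (Set.Ici 0) := strictMonoOn_of_deriv_pos (convex_Ici 0)
    h.continuous_u.continuousOn fun x hx => by
      rw [interior_Ici] at hx
      rw [(h.du x).deriv]
      exact hpos x hx
  have hlt : ∀ x, 0 ≤ x → u x < up := by
    intro x hx
    by_contra! hge
    obtain ⟨y, hy, hyu⟩ := intermediate_value_Icc hx h.continuous_u.continuousOn
      ⟨by rw [h.u0]; exact hw.lt.le, hge⟩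
    have hy0 : 0 < y := by
      rcases hy.1.eq_or_lt with h0 | h0
      · rw [← h0, h.u0] at hyu
        exact absurd hyu hw.lt.ne
      · exact h0
    have := hen y
    rw [hyu, hw.right_root] at this
    have := hpos y hy0
    nlinarith
  set d := g up - a - c * up with hd
  have hd0 : 0 < d := hw.right_deriv_pos hg
  obtain ⟨η, hη, hball⟩ : ∃ η > 0, ∀ v, |v - up| < η → d / 2 < g v - a - c * v := by
    have hc : Continuous fun v => g v - a - c * v := by fun_prop
    have := (hc.tendsto up).eventually_const_lt (show d / 2 < g up - a - c * up by linarith)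
    obtain ⟨η, hη, hb⟩ := Metric.eventually_nhds_iff.1 this
    exact ⟨η, hη, fun v hv => hb (by rwa [Real.dist_eq])⟩
  by_cases hcase : ∃ x > 0, up - η < u x
  · obtain ⟨x₁, hx₁, hux⟩ := hcase
    have hp1 := hpos x₁ hx₁
    have hle := Convex.image_sub_le_mul_sub_of_deriv_le (convex_Ici x₁) (f := p)
      h.continuous_p.continuousOn (fun x _ => (h.dp x).differentiableAt.differentiableWithinAt)
      (C := -(d / 2)) (fun x hx => by
        rw [interior_Ici] at hx
        have hx' : x₁ < x := hx
        have h1 : u x₁ < u x := hmono hx₁.le (hx₁.trans hx').le hx'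
        have h2 := hlt x (hx₁.trans hx').le
        have := hball (u x) (abs_lt.2 ⟨by linarith, by linarith⟩)
        rw [(h.dp x).deriv]
        linarith) x₁ Set.self_mem_Ici (x₁ + p x₁ / (d / 2)) (by
          have : 0 < p x₁ / (d / 2) := by positivity
          simp [this.le]) (by
          have : 0 < p x₁ / (d / 2) := by positivity
          linarith)
    have hq := hpos (x₁ + p x₁ / (d / 2)) (by positivity)
    have : -(d / 2) * (x₁ + p x₁ / (d / 2) - x₁) = - p x₁ := by field_simp; ring
    linarith
  · push Not at hcase
    have hu1 : um < u 1 := by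
      have := hmono Set.self_mem_Ici (show (0 : ℝ) ≤ 1 by norm_num) one_pos
      rwa [h.u0] at this
    have hcont : Continuous (potential g a c) :=
      continuous_iff_continuousAt.2 fun x => (hasDerivAt_potential hg a c x).continuousAt
    obtain ⟨v₀, hv₀, hmax⟩ := isCompact_Icc.exists_isMaxOn
      (Set.nonempty_Icc.2 (hcase 1 one_pos)) (hcont.continuousOn (s := Set.Icc (u 1) (up - η)))
    set κ := E - potential g a c v₀ with hκ
    have hκ0 : 0 < κ := sub_pos.2 (hw.below v₀ ⟨hu1.trans_le hv₀.1, by linarith [hv₀.2]⟩)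
    have hple : ∀ x, 1 < x → √(2 * κ) ≤ p x := fun x hx => by
      have hx0 : 0 < x := one_pos.trans hx
      have h1 : u 1 < u x := hmono (show (0 : ℝ) ≤ 1 by norm_num) hx0.le hx
      have h2 := hmax (show u x ∈ Set.Icc (u 1) (up - η) from ⟨h1.le, hcase x hx0⟩)
      have h2' : potential g a c (u x) ≤ potential g a c v₀ := h2
      have h3 := hen x
      rw [Real.sqrt_le_left (hpos x hx0).le]
      linarith
    have hs : 0 < √(2 * κ) := Real.sqrt_pos.2 (by positivity)
    set X := 1 + (up - u 1) / √(2 * κ) with hX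
    have hu1' := hlt 1 zero_le_one
    have hX1 : 1 ≤ X := by
      have : 0 ≤ (up - u 1) / √(2 * κ) := div_nonneg (by linarith) hs.le
      linarith
    have hle := Convex.mul_sub_le_image_sub_of_le_deriv (convex_Ici (1 : ℝ)) (f := u)
      h.continuous_u.continuousOn (fun x _ => (h.du x).differentiableAt.differentiableWithinAt)
      (C := √(2 * κ)) (fun x hx => by
        rw [interior_Ici] at hx
        rw [(h.du x).deriv]
        exact hple x hx) 1 Set.self_mem_Ici X hX1 hX1
    have : √(2 * κ) * (X - 1) = up - u 1 := by rw [hX]; field_simp; ring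
    have := hlt X (by linarith)
    linarith

/-- The half period of a solution in a potential well. -/
theorem IsNewton.exists_half_period {g : ℝ → ℝ} (hg : Continuous g) {a E c um up : ℝ}
    (hw : IsPotentialWell g a E c um up) {u p : ℝ → ℝ} (h : IsNewton g a c um u p) :
    ∃ τ > 0, p τ = 0 ∧ (∀ x ∈ Set.Ioo 0 τ, 0 < p x) ∧ u τ = up := by
  have hβ : 0 < a + c * um - g um := by linarith [hw.left_deriv_neg hg]
  have hev := eventually_pos_right_of_hasDerivAt (h.dp 0) h.p0 (by rw [h.u0]; exact hβ)
  obtain ⟨δ, hδ, hpos⟩ := mem_nhdsGT_iff_exists_Ioo_subset.1 hev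
  have hδ : 0 < δ := hδ
  obtain ⟨x₁, hx₁, hpx₁⟩ := h.exists_turning_point hg hw
  -- Since p also vanishes at 0, the search for the first later zero starts inside the interval (0,
  -- δ) on which p > 0.
  set S : Set ℝ := Set.Icc (δ / 2) x₁ ∩ p ⁻¹' Set.Iic 0 with hS
  have hδ2 : δ / 2 ≤ x₁ := by
    by_contra! hlt
    exact absurd (hpos (show x₁ ∈ Set.Ioo 0 δ from ⟨hx₁, by linarith⟩)) (not_lt.2 hpx₁)
  have hScomp : IsCompact S := isCompact_Icc.inter_right (isClosed_Iic.preimage h.continuous_p)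
  obtain ⟨τ, hτ⟩ := hScomp.exists_isLeast ⟨x₁, ⟨hδ2, le_rfl⟩, hpx₁⟩
  have hτ0 : 0 < τ := by linarith [hτ.1.1.1]
  have hpτ : ∀ x ∈ Set.Ioo 0 τ, 0 < p x := by
    intro x hx
    by_contra! hle
    rcases lt_or_ge x (δ / 2) with h1 | h1
    · exact absurd (hpos (show x ∈ Set.Ioo 0 δ from ⟨hx.1, by linarith⟩)) (not_lt.2 hle)
    · exact absurd (hτ.2 ⟨⟨h1, hx.2.le.trans hτ.1.1.2⟩, hle⟩) (not_le.2 hx.2)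
  have hτz : p τ = 0 := by
    refine le_antisymm hτ.1.2 ?_
    have : Tendsto p (𝓝[<] τ) (𝓝 (p τ)) := h.continuous_p.continuousAt.mono_left inf_le_left
    refine ge_of_tendsto this ?_
    filter_upwards [Ioo_mem_nhdsLT hτ0] with x hx using (hpτ x hx).le
  refine ⟨τ, hτ0, hτz, hpτ, ?_⟩
  have hen := fun x => h.energy_eq hg x
  rw [hw.left_root] at hen
  have hmono : StrictMonoOn u (Set.Icc 0 τ) := strictMonoOn_of_deriv_pos (convex_Icc 0 τ)
    h.continuous_u.continuousOn fun x hx => by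
      rw [interior_Icc] at hx
      rw [(h.du x).deriv]
      exact hpτ x hx
  have hτm : τ ∈ Set.Icc 0 τ := ⟨hτ0.le, le_rfl⟩
  have h0m : (0 : ℝ) ∈ Set.Icc 0 τ := ⟨le_rfl, hτ0.le⟩
  -- With p τ = 0 energy puts u τ on the level E, hence outside the open well. An overshoot would
  -- cross `up` before τ, where energy forces p = 0.
  have hle : up ≤ u τ := by
    by_contra! hlt
    have h1 := hmono h0m hτm hτ0
    rw [h.u0] at h1
    have h2 := hw.below (u τ) ⟨h1, hlt⟩
    have h3 := hen τ
    rw [hτz] at h3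
    linarith
  refine le_antisymm ?_ hle
  by_contra! hlt
  obtain ⟨y, hy, hyu⟩ := intermediate_value_Icc hτ0.le h.continuous_u.continuousOn
      ⟨by rw [h.u0]; exact hw.lt.le, hle⟩
  have hy0 : 0 < y := by
    rcases hy.1.eq_or_lt with h0 | h0
    · rw [← h0, h.u0] at hyu
      exact absurd hyu hw.lt.ne
    · exact h0
  have hyτ : y < τ := by
    rcases hy.2.eq_or_lt with h0 | h0
    · rw [h0] at hyu
      exact absurd hyu.symm hlt.ne
    · exact h0
  have h3 := hen y
  rw [hyu, hw.right_root] at h3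
  have := hpτ y ⟨hy0, hyτ⟩
  nlinarith

/-- Persistence of the first positive zero of `P 0` under `C¹` small perturbations. -/
theorem eventually_exists_first_zero {P Q : ℝ → ℝ → ℝ} {τ L : ℝ}
    (hd : ∀ t x, HasDerivAt (P t) (Q t x) x) (hQ : Continuous (Q 0)) (h0 : ∀ t, P t 0 = 0)
    (hQ0 : 0 < Q 0 0) (hτ0 : 0 < τ) (hτL : τ < L) (hpos : ∀ x ∈ Set.Ioo 0 τ, 0 < P 0 x)
    (hzero : P 0 τ = 0) (hQτ : Q 0 τ < 0)
    (hP : ∀ ε > 0, ∀ᶠ t in 𝓝 (0 : ℝ), ∀ x ∈ Set.Icc 0 L, |P t x - P 0 x| ≤ ε)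
    (hQ' : ∀ ε > 0, ∀ᶠ t in 𝓝 (0 : ℝ), ∀ x ∈ Set.Icc 0 L, |Q t x - Q 0 x| ≤ ε)
    {δ : ℝ} (hδ : 0 < δ) :
    ∀ᶠ t in 𝓝 (0 : ℝ), ∃ y, |y - τ| < δ ∧ 0 < y ∧ P t y = 0 ∧ ∀ x ∈ Set.Ioo 0 y, 0 < P t x := by
  obtain ⟨δ₁, hδ₁, hb₁⟩ : ∃ η > 0, ∀ x, |x| < η → Q 0 0 / 2 < Q 0 x := by
    obtain ⟨η, hη, hb⟩ := Metric.eventually_nhds_iff.1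
      ((hQ.tendsto 0).eventually_const_lt (show Q 0 0 / 2 < Q 0 0 by linarith))
    exact ⟨η, hη, fun v hv => hb (by rwa [Real.dist_eq, sub_zero])⟩
  obtain ⟨δ₂, hδ₂, hb₂⟩ : ∃ η > 0, ∀ x, |x - τ| < η → Q 0 x < Q 0 τ / 2 := by
    obtain ⟨η, hη, hb⟩ := Metric.eventually_nhds_iff.1
      ((hQ.tendsto τ).eventually_lt_const (show Q 0 τ < Q 0 τ / 2 by linarith))
    exact ⟨η, hη, fun v hv => hb (by rwa [Real.dist_eq])⟩
  -- The sign of P t is controlled on three zones: on (0, ρ] by P t 0 = 0 and a positive derivative,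
  -- on [ρ, τ - ρ] by uniform closeness to P 0, and on [τ - ρ, τ + ρ] by strict decrease through the
  -- new zero.
  obtain ⟨ρ, hρ0, hρ⟩ : ∃ ρ > 0, ρ < δ ∧ ρ < δ₁ ∧ ρ < δ₂ ∧ ρ < L - τ ∧ ρ < τ / 2 := by
    set M := min δ (min δ₁ (min δ₂ (min (L - τ) (τ / 2)))) with hM
    have hM0 : 0 < M := by
      simp only [hM, lt_min_iff]
      exact ⟨hδ, hδ₁, hδ₂, by linarith, by linarith⟩
    have : M / 2 < M := half_lt_self hM0
    refine ⟨M / 2, half_pos hM0, ?_⟩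
    simpa only [hM, lt_min_iff] using this
  obtain ⟨hρδ, hρ1, hρ2, hρL, hρτ⟩ := hρ
  have hcont : ∀ t, Continuous (P t) := fun t =>
    continuous_iff_continuousAt.2 fun x => (hd t x).continuousAt
  have hanti : ∀ t, (∀ x ∈ Set.Icc 0 L, |Q t x - Q 0 x| ≤ -(Q 0 τ) / 4) →
      StrictAntiOn (P t) (Set.Icc (τ - ρ) (τ + ρ)) := fun t ht =>
    strictAntiOn_of_deriv_neg (convex_Icc _ _) (hcont t).continuousOn fun x hx => by
      rw [interior_Icc] at hx
      rw [(hd t x).deriv]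
      have h1 := hb₂ x (abs_lt.2 ⟨by linarith [hx.1], by linarith [hx.2]⟩)
      have h2 := (abs_le.1 (ht x ⟨by linarith [hx.1], by linarith [hx.2]⟩)).2
      linarith
  have hneg : P 0 (τ + ρ) < 0 := by
    have := hanti 0 (fun x _ => by rw [sub_self, abs_zero]; linarith)
      (show τ ∈ _ from ⟨by linarith, by linarith⟩) (show τ + ρ ∈ _ from ⟨by linarith, le_rfl⟩)
      (by linarith)
    rwa [hzero] at this
  obtain ⟨κ, hκ0, hκ⟩ : ∃ κ > 0, ∀ x ∈ Set.Icc ρ (τ - ρ), κ ≤ P 0 x := by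
    have hne : (Set.Icc ρ (τ - ρ)).Nonempty := Set.nonempty_Icc.2 (by linarith)
    obtain ⟨x₀, hx₀, hmin⟩ := isCompact_Icc.exists_isMinOn hne (hcont 0).continuousOn
    exact ⟨P 0 x₀, hpos x₀ ⟨by linarith [hx₀.1], by linarith [hx₀.2]⟩, fun x hx => hmin hx⟩
  filter_upwards [hP (κ / 2) (half_pos hκ0), hP (-(P 0 (τ + ρ)) / 2) (by linarith),
    hQ' (Q 0 0 / 4) (by linarith), hQ' (-(Q 0 τ) / 4) (by linarith)] with t h1 h2 h3 h4
  have hmid : ∀ x ∈ Set.Icc ρ (τ - ρ), 0 < P t x := fun x hx => by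
    have := (abs_le.1 (h1 x ⟨by linarith [hx.1], by linarith [hx.2]⟩)).1
    linarith [hκ x hx]
  have hend : P t (τ + ρ) < 0 := by
    have := (abs_le.1 (h2 (τ + ρ) ⟨by linarith, by linarith⟩)).2
    linarith
  have hstart : StrictMonoOn (P t) (Set.Icc 0 ρ) :=
    strictMonoOn_of_deriv_pos (convex_Icc _ _) (hcont t).continuousOn fun x hx => by
      rw [interior_Icc] at hx
      rw [(hd t x).deriv]
      have h5 := hb₁ x (abs_lt.2 ⟨by linarith [hx.1], by linarith [hx.2]⟩)
      have h6 := (abs_le.1 (h3 x ⟨by linarith [hx.1], by linarith [hx.2]⟩)).1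
      linarith
  obtain ⟨y, hy, hyz⟩ := intermediate_value_Icc' (show τ - ρ ≤ τ + ρ by linarith)
    (hcont t).continuousOn
    (show (0 : ℝ) ∈ _ from ⟨hend.le, (hmid (τ - ρ) ⟨by linarith, le_rfl⟩).le⟩)
  refine ⟨y, abs_lt.2 ⟨by linarith [hy.1], by linarith [hy.2]⟩, by linarith [hy.1], hyz, ?_⟩
  intro x hx
  rcases le_or_gt x ρ with hxρ | hxρ
  · have := hstart ⟨le_rfl, hρ0.le⟩ ⟨hx.1.le, hxρ⟩ hx.1
    rwa [h0] at this
  rcases le_or_gt x (τ - ρ) with hxτ | hxτ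
  · exact hmid x ⟨hxρ.le, hxτ⟩
  · have := hanti t h4 ⟨hxτ.le, hx.2.le.trans hy.2⟩ hy hx.2
    rwa [hyz] at this

/-! ### Identification of `uMinus`, `uPlus`, `period` and `profile` with the dynamical solution. -/

variable {f : ℝ → ℝ} {a c b E m τ : ℝ} {u p : ℝ → ℝ}

namespace IsNewton

theorem strictMonoOn (h : IsNewton f a c b u p) (hpos : ∀ x ∈ Set.Ioo 0 τ, 0 < p x) :
    StrictMonoOn u (Set.Icc 0 τ) :=
  strictMonoOn_of_deriv_pos (convex_Icc 0 τ) h.continuous_u.continuousOn fun x hx => by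
    rw [interior_Icc] at hx
    rw [(h.du x).deriv]
    exact hpos x hx

theorem image_Ioo (h : IsNewton f a c b u p) (hτ : 0 < τ)
    (hpos : ∀ x ∈ Set.Ioo 0 τ, 0 < p x) : u '' Set.Ioo 0 τ = Set.Ioo b (u τ) := by
  have hm := h.strictMonoOn hpos
  have h0 : (0 : ℝ) ∈ Set.Icc 0 τ := ⟨le_rfl, hτ.le⟩
  have h1 : τ ∈ Set.Icc 0 τ := ⟨hτ.le, le_rfl⟩
  rw [← h.u0]
  refine Set.Subset.antisymm ?_ (intermediate_value_Ioo hτ.le h.continuous_u.continuousOn)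
  rintro _ ⟨x, hx, rfl⟩
  exact ⟨hm h0 ⟨hx.1.le, hx.2.le⟩ hx.1, hm ⟨hx.1.le, hx.2.le⟩ h1 hx.2⟩

/-- The range of a solution lies between its values at two consecutive turning points. -/
theorem mem_Icc (hf : ContDiff ℝ 1 f) (h : IsNewton f a c b u p) (hτ : 0 < τ)
    (hpos : ∀ x ∈ Set.Ioo 0 τ, 0 < p x) (hpτ : p τ = 0) (x : ℝ) : u x ∈ Set.Icc b (u τ) := by
  have hm := (h.strictMonoOn hpos).monotoneOn
  obtain ⟨y, hy, hxy⟩ := (h.periodic hf hpτ).1.exists_mem_Ico (by linarith : 0 < 2 * τ) x (-τ)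
  have hy' : |y| ∈ Set.Icc 0 τ := ⟨abs_nonneg y, abs_le.2 ⟨hy.1, by linarith [hy.2]⟩⟩
  have huy : u |y| = u y := by
    rcases abs_choice y with h1 | h1 <;> rw [h1]
    exact (h.even hf y).1
  rw [hxy, ← huy, ← h.u0]
  exact ⟨hm ⟨le_rfl, hτ.le⟩ hy' hy'.1, hm hy' ⟨hτ.le, le_rfl⟩ hy'.2⟩

section Period

variable (hf : Continuous f) (h : IsNewton f a c b u p) (hτ : 0 < τ)
  (hpos : ∀ x ∈ Set.Ioo 0 τ, 0 < p x) (hpτ : p τ = 0) (hE : potential f a c b = E)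
  (hm : m ∈ Set.Ioo b (u τ))

include hf h hτ hpos hE in
theorem potential_lt {v : ℝ} (hv : v ∈ Set.Ioo b (u τ)) : potential f a c v < E := by
  rw [← h.image_Ioo hτ hpos] at hv
  obtain ⟨x, hx, rfl⟩ := hv
  have h1 := h.energy_eq hf x
  have h2 := hpos x hx
  nlinarith

include hf h hτ hpos hE hm in
theorem uMinus_eq : uMinus f m a E c = b := by
  refine IsGreatest.csSup_eq ⟨⟨hm.1, hE.ge⟩, fun v hv => ?_⟩
  by_contra! hlt
  exact absurd hv.2 (not_le.2 (h.potential_lt hf hτ hpos hE ⟨hlt, hv.1.trans hm.2⟩))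

include hf h hτ hpos hpτ hE hm in
theorem uPlus_eq : uPlus f m a E c = u τ := by
  have h1 := h.energy_eq hf τ
  rw [hpτ, hE] at h1
  refine IsLeast.csInf_eq ⟨⟨hm.2, by linarith⟩, fun v hv => ?_⟩
  by_contra! hlt
  exact absurd hv.2 (not_le.2 (h.potential_lt hf hτ hpos hE ⟨hm.1.trans hv.1, hlt⟩))

include hf h hτ hpos hpτ hE hm in
/-- The quadrature formula for the period agrees with twice the time between turning points. -/
theorem period_eq : period f m a E c = 2 * τ := by
  have hble : b ≤ u τ := hm.1.le.trans hm.2.le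
  -- Substitute v = u(x) for x in (0, τ). Energy gives E - V(u) = p²/2, so the endpoint
  -- singularities cancel against du = p dx and the integrand becomes the constant √2.
  rw [period, h.uMinus_eq hf hτ hpos hE hm, h.uPlus_eq hf hτ hpos hpτ hE hm,
    intervalIntegral.integral_of_le hble, MeasureTheory.integral_Ioc_eq_integral_Ioo,
    ← h.image_Ioo hτ hpos,
    MeasureTheory.integral_image_eq_integral_abs_deriv_smul measurableSet_Ioo
      (fun x _ => (h.du x).hasDerivWithinAt)
      ((h.strictMonoOn hpos).injOn.mono Set.Ioo_subset_Icc_self),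
    MeasureTheory.setIntegral_congr_fun (g := fun _ => √2) measurableSet_Ioo]
  · simp [hτ.le]
    rw [← mul_assoc, mul_comm (√2), mul_assoc, Real.mul_self_sqrt (by norm_num)]
    ring
  · intro x hx
    have h1 := h.energy_eq hf x
    have h2 := hpos x hx
    have h3 : E - potential f a c (u x) = p x ^ 2 / 2 := by linarith
    have h4 : (0 : ℝ) < √2 := by positivity
    simp only [h3, smul_eq_mul, abs_of_pos h2]
    rw [Real.sqrt_div (sq_nonneg _), Real.sqrt_sq h2.le]
    field_simp

end Period

theorem isProfile (hf : ContDiff ℝ 2 f) (h : IsNewton f a c b u p) {y : ℝ} (hy : p y ≠ 0)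
    (hE : potential f a c b = E) (hb : uMinus f m a E c = b) : IsProfile f m a E c u := by
  have hdu : deriv u = p := funext fun x => (h.du x).deriv
  have hdp : deriv p = fun x => a + c * u x - f (u x) := funext fun x => (h.dp x).deriv
  have hf1 : ContDiff ℝ 1 f := hf.of_le (by norm_num)
  have hu1 : ContDiff ℝ 1 u := contDiff_one_iff_deriv.2
    ⟨fun x => (h.du x).differentiableAt, hdu ▸ h.continuous_p⟩
  have hp2 : ContDiff ℝ 2 p := (contDiff_succ_iff_deriv (n := 1)).2
    ⟨fun x => (h.dp x).differentiableAt, by simp, by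
      rw [hdp]
      have := hf1.comp hu1
      simp only [Function.comp_def] at this
      fun_prop⟩
  have hdf : ∀ x, HasDerivAt f (deriv f x) x := fun x =>
    (hf1.differentiable (by norm_num) x).hasDerivAt
  refine ⟨(contDiff_succ_iff_deriv (n := 2)).2
    ⟨fun x => (h.du x).differentiableAt, by simp, hdu ▸ hp2⟩, fun x => ?_, fun x => ?_, ?_, ?_⟩
  · have h3 : HasDerivAt (fun x => a + c * u x - f (u x)) (c * p x - deriv f (u x) * p x) x := by
      have := (((h.du x).const_mul c).const_add a).sub ((hdf (u x)).comp x (h.du x))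
      exact this
    have h4 : HasDerivAt (fun y => f (u y)) (deriv f (u x) * p x) x := (hdf (u x)).comp x (h.du x)
    rw [iteratedDeriv_succ, iteratedDeriv_succ, iteratedDeriv_succ, iteratedDeriv_zero, hdu, hdp,
      h3.deriv, h4.deriv]
    ring
  · have := h.energy_eq hf1.continuous x
    rw [hE, potential] at this
    rw [hdu]
    linarith
  · rw [h.u0, hb]
  · by_contra! hc
    refine hy ?_
    have : u = fun _ => u 0 := funext hc
    have h1 := (h.du y).deriv
    rw [this] at h1
    simpa using h1.symm

end IsNewton

/-- The third order equation integrates to u'' + f(u) - cu = k. Differentiating the quadrature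
relation gives u'(k - a) = 0 everywhere, and a nonconstant u forces k = a. Thus the solution chosen
in `profile` is pinned down by uniqueness for the initial value problem. -/
theorem IsProfile.isNewton (hf : ContDiff ℝ 2 f) (h : IsProfile f m a E c u)
    (hE : potential f a c b = E) (hb : uMinus f m a E c = b) : IsNewton f a c b u (deriv u) := by
  have hf1 : ContDiff ℝ 1 f := hf.of_le (by norm_num)
  have hdf : ∀ x, HasDerivAt f (deriv f x) x := fun x =>
    (hf1.differentiable (by norm_num) x).hasDerivAt
  have hu2 : ContDiff ℝ 2 (deriv u) := ((contDiff_succ_iff_deriv (n := 2)).1 h.contDiff).2.2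
  have hu1 : ContDiff ℝ 1 (deriv (deriv u)) := contDiff_one_deriv hu2
  have d0 : ∀ x, HasDerivAt u (deriv u x) x := fun x =>
    (h.contDiff.differentiable (by norm_num) x).hasDerivAt
  have d1 : ∀ x, HasDerivAt (deriv u) (deriv (deriv u) x) x := fun x =>
    (hu2.differentiable (by norm_num) x).hasDerivAt
  have d2 : ∀ x, HasDerivAt (deriv (deriv u)) (deriv (deriv (deriv u)) x) x := fun x =>
    (hu1.differentiable (by norm_num) x).hasDerivAt
  have df : ∀ x, HasDerivAt (fun y => f (u y)) (deriv f (u x) * deriv u x) x := fun x =>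
    (hdf (u x)).comp x (d0 x)
  have hk : ∀ x, HasDerivAt (fun y => deriv (deriv u) y + f (u y) - c * u y) 0 x := fun x => by
    refine (((d2 x).add (df x)).sub ((d0 x).const_mul c)).congr_deriv ?_
    have := h.travelling x
    rw [(df x).deriv, iteratedDeriv_succ, iteratedDeriv_succ, iteratedDeriv_succ,
      iteratedDeriv_zero] at this
    exact this
  have hconst := fun x => is_const_of_deriv_eq_zero (fun x => (hk x).differentiableAt)
    (fun x => (hk x).deriv) x 0
  set k := deriv (deriv u) 0 + f (u 0) - c * u 0 with hkdef
  have hmul : ∀ x, deriv u x * (k - a) = 0 := fun x => by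
    have h1 : HasDerivAt (fun x => (deriv u x) ^ 2 / 2)
        (deriv u x * deriv (deriv u) x) x := by
      refine (((d1 x).pow 2).div_const 2).congr_deriv ?_
      push_cast
      ring
    have h2 : HasDerivAt (fun x => E + a * u x + c / 2 * (u x) ^ 2 - antideriv f (u x))
        (a * deriv u x + c * u x * deriv u x - f (u x) * deriv u x) x := by
      refine (((((d0 x).const_mul a).const_add E).add (((d0 x).pow 2).const_mul (c / 2))).sub
        ((hasDerivAt_antideriv hf1.continuous (u x)).comp x (d0 x))).congr_deriv ?_
      push_cast
      ring
    rw [funext h.quadrature] at h1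
    have h3 := h1.unique h2
    have h4 : deriv (deriv u) x = k - f (u x) + c * u x := by
      have := hconst x
      linarith
    rw [h4] at h3
    linear_combination h3
  have hka : k = a := by
    obtain ⟨x, hx⟩ := h.nonconstant
    by_contra hne
    refine hx (is_const_of_deriv_eq_zero (fun x => (d0 x).differentiableAt) (fun x => ?_) x 0)
    exact (mul_eq_zero.1 (hmul x)).resolve_right (sub_ne_zero.2 hne)
  refine ⟨d0, fun x => (d1 x).congr_deriv ?_, by rw [h.init, hb], ?_⟩
  · have := hconst x
    linarith
  · have := h.quadrature 0
    rw [h.init, hb] at this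
    rw [potential] at hE
    have : deriv u 0 ^ 2 = 0 := by linarith
    exact pow_eq_zero_iff (by norm_num) |>.1 this

theorem IsNewton.profile_eq (hf : ContDiff ℝ 2 f) (h : IsNewton f a c b u p) {y : ℝ}
    (hy : p y ≠ 0) (hE : potential f a c b = E) (hb : uMinus f m a E c = b) :
    profile f m a E c = u := by
  have hex : ∃ u, IsProfile f m a E c u := ⟨u, h.isProfile hf hy hE hb⟩
  have hspec : IsProfile f m a E c (profile f m a E c) := by
    rw [profile, dif_pos hex]
    exact hex.choose_spec
  have h' := hspec.isNewton hf hE hb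
  exact (IsNewton.eq_of_initial (hf.of_le (by norm_num)) h'.du h'.dp h.du h.dp
    (h'.u0.trans h.u0.symm) (h'.p0.trans h.p0.symm)).1

/-! ### Truncation of f, and the derivatives of period, mass and momentum. -/

/-- Waves with values in [-R, R] cannot distinguish f from its cutoff, and the cutoff has a global
flow with the uniform bounds that the Grönwall arguments need. -/
theorem exists_isTame_eqOn {f : ℝ → ℝ} (hf : ContDiff ℝ 2 f) {R : ℝ} (hR : 0 < R) :
    ∃ g K, IsTame g K ∧ ∀ v ∈ Set.Icc (-R) R, g v = f v := by
  let φ : ContDiffBump (0 : ℝ) := ⟨R, R + 1, hR, by linarith⟩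
  have hg : ContDiff ℝ 2 fun x => φ x * f x := φ.contDiff.mul hf
  have hs : HasCompactSupport fun x => φ x * f x := φ.hasCompactSupport.mul_right
  obtain ⟨K₀, h₀⟩ := hs.exists_bound_of_continuous hg.continuous
  obtain ⟨K₁, h₁⟩ := hs.deriv.exists_bound_of_continuous (contDiff_one_deriv hg).continuous
  obtain ⟨K₂, h₂⟩ := hs.deriv.deriv.exists_bound_of_continuous
    ((contDiff_one_deriv hg).continuous_deriv le_rfl)
  refine ⟨_, max K₀ (max K₁ K₂), ⟨hg, fun x => (h₀ x).trans (le_max_left _ _),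
    fun x => (h₁ x).trans ((le_max_left _ _).trans (le_max_right _ _)),
    fun x => (h₂ x).trans ((le_max_right _ _).trans (le_max_right _ _))⟩, fun v hv => ?_⟩
  rw [φ.one_of_mem_closedBall (by
    rw [mem_closedBall_zero_iff]
    exact abs_le.2 hv), one_mul]

/-- The interval has to contain 0, the base point of `antideriv`. -/
theorem potential_congr {f g : ℝ → ℝ} {R : ℝ} (hR : 0 < R)
    (h : ∀ v ∈ Set.Icc (-R) R, g v = f v) (a c : ℝ) {v : ℝ} (hv : v ∈ Set.Icc (-R) R) :
    potential g a c v = potential f a c v := by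
  have : antideriv g v = antideriv f v := intervalIntegral.integral_congr fun x hx =>
    h x (Set.uIcc_subset_Icc ⟨by linarith, hR.le⟩ hv hx)
  rw [potential, potential, this]

theorem IsPotentialWell.congr {f g : ℝ → ℝ} (hf : Continuous f) (hg : Continuous g) {R : ℝ}
    (hR : 0 < R) (h : ∀ v ∈ Set.Icc (-R) R, g v = f v) {a E c um up : ℝ}
    (hw : IsPotentialWell f a E c um up) (hum : um ∈ Set.Icc (-R) R)
    (hup : up ∈ Set.Icc (-R) R) : IsPotentialWell g a E c um up where
  lt := hw.lt
  left_root := (potential_congr hR h a c hum).trans hw.left_root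
  right_root := (potential_congr hR h a c hup).trans hw.right_root
  left_simple := by
    rw [(hasDerivAt_potential hg a c um).deriv, h um hum, ← (hasDerivAt_potential hf a c um).deriv]
    exact hw.left_simple
  right_simple := by
    rw [(hasDerivAt_potential hg a c up).deriv, h up hup, ← (hasDerivAt_potential hf a c up).deriv]
    exact hw.right_simple
  below := fun v hv => by
    rw [potential_congr hR h a c ⟨hum.1.trans hv.1.le, hv.2.le.trans hup.2⟩]
    exact hw.below v hv

theorem IsNewton.congr {f g : ℝ → ℝ} {a c b : ℝ} {u p : ℝ → ℝ} (h : IsNewton g a c b u p)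
    (hfg : ∀ x, g (u x) = f (u x)) : IsNewton f a c b u p :=
  ⟨h.du, fun x => hfg x ▸ h.dp x, h.u0, h.p0⟩

/-- Continuation of a simple root of `E - V(·; a, c)` along a line in parameter space. -/
theorem exists_root_path {g : ℝ → ℝ} (hg : Continuous g) {a c E b β : ℝ}
    (hb : potential g a c b = E) (hβ : a + c * b - g b = β) (hβ0 : β ≠ 0) (α e γ : ℝ) :
    ∃ y : ℝ → ℝ, y 0 = b ∧ HasDerivAt y (-(e + α * b + γ / 2 * b ^ 2) / β) 0 ∧
      ∀ᶠ t in 𝓝 (0 : ℝ), potential g (a + t * α) (c + t * γ) (y t) = E + t * e := by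
  let W : ℝ → ℝ → ℝ := fun t v => E + t * e - potential g (a + t * α) (c + t * γ) v
  have hW : ContDiff ℝ 1 fun z : ℝ × ℝ => W z.1 z.2 := by
    have h1 : ContDiff ℝ 1 (antideriv g) := contDiff_one_iff_deriv.2
      ⟨fun x => (hasDerivAt_antideriv hg x).differentiableAt, by
        rw [funext fun x => (hasDerivAt_antideriv hg x).deriv]
        exact hg⟩
    have := h1.comp (contDiff_snd : ContDiff ℝ 1 fun z : ℝ × ℝ => z.2)
    simp only [Function.comp_def] at this
    simp only [W, potential]
    fun_prop
  have hd : ∀ x, HasDerivAt (W 0) (a + c * x - g x) x := fun x => by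
    have := (hasDerivAt_potential hg (a + 0 * α) (c + 0 * γ) x).const_sub (E + 0 * e)
    refine this.congr_deriv (by ring)
  have hW0 : W 0 b = 0 := by simp [W, hb]
  have hs := hW.contDiffAt.hasStrictFDerivAt (x := (0, b)) (by norm_num)
  have hinr : (fderiv ℝ (fun z : ℝ × ℝ => W z.1 z.2) (0, b)) ∘L .inr ℝ ℝ ℝ
      = ((ContinuousLinearEquiv.unitsEquivAut ℝ (Units.mk0 β hβ0) : ℝ ≃L[ℝ] ℝ) : ℝ →L[ℝ] ℝ) := by
    have h1 : HasFDerivAt (W 0)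
        ((fderiv ℝ (fun z : ℝ × ℝ => W z.1 z.2) (0, b)) ∘L .inr ℝ ℝ ℝ) b :=
      hs.hasFDerivAt.comp b (hasFDerivAt_prodMk_right (0 : ℝ) b)
    have h2 := h1.hasDerivAt.unique (hd b)
    ext
    simp only [ContinuousLinearEquiv.coe_coe, ContinuousLinearEquiv.unitsEquivAut_apply,
      Units.val_mk0, one_mul]
    rw [← hβ, ← h2]
  have hinv : ((fderiv ℝ (fun z : ℝ × ℝ => W z.1 z.2) (0, b)) ∘L .inr ℝ ℝ ℝ).IsInvertible :=
    ⟨_, hinr.symm⟩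
  set y := hs.implicitFunctionOfProdDomain hinv with hy
  have hy0 : y 0 = b :=
    (hs.eventually_apply_eq_iff_implicitFunctionOfProdDomain hinv).self_of_nhds.1 rfl
  have hyt : Tendsto y (𝓝 0) (𝓝 b) := hs.tendsto_implicitFunctionOfProdDomain hinv
  have hroot : ∀ᶠ t in 𝓝 (0 : ℝ), W t (y t) = 0 := by
    filter_upwards [hs.eventually_apply_implicitFunctionOfProdDomain hinv] with t ht
    exact ht.trans hW0
  refine ⟨y, hy0, ?_, ?_⟩
  · have hu : HasUniformDerivOn W (fun v => e + α * v + γ / 2 * v ^ 2) Set.univ := by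
      intro ε hε
      refine Eventually.of_forall fun t v _ => ?_
      have : W t v - W 0 v - t * (e + α * v + γ / 2 * v ^ 2) = 0 := by
        simp only [W, potential]
        ring
      rw [this, abs_zero]
      positivity
    exact hu.hasDerivAt_root univ_mem (hβ ▸ hd b) hβ0 (by fun_prop) hyt hy0 hroot
  · filter_upwards [hroot] with t ht
    linarith

/-- Period, mass and momentum are differentiable along lines in parameter space, with derivatives
given by the solution of the linearized equation. -/
theorem exists_wave_variation {f : ℝ → ℝ} (hf : ContDiff ℝ 2 f) {a E c um up m : ℝ}
    (hwell : IsPotentialWell f a E c um up) (hm : m ∈ Set.Ioo um up) :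
    ∃ p β, 0 < β ∧ β = a + c * um - f um ∧ IsNewton f a c um (profile f m a E c) p ∧
      0 < period f m a E c ∧ p (period f m a E c) = 0 ∧
      profile f m a E c (period f m a E c) = um ∧
      ∀ α e γ : ℝ, ∃ v r T', IsVariation f c α γ (profile f m a E c) v r ∧
        v 0 = -(e + α * um + γ / 2 * um ^ 2) / β ∧
        r (period f m a E c) = -T' * β ∧
        HasDerivAt (fun t => period f m (a + t * α) (E + t * e) (c + t * γ)) T' 0 ∧
        HasDerivAt (fun t => mass f m (a + t * α) (E + t * e) (c + t * γ))
          ((∫ x in (0 : ℝ)..(period f m a E c), v x) + T' * um) 0 ∧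
        HasDerivAt (fun t => momentum f m (a + t * α) (E + t * e) (c + t * γ))
          ((∫ x in (0 : ℝ)..(period f m a E c), 2 * profile f m a E c x * v x)
            + T' * um ^ 2) 0 := by
  -- The margin keeps [um - 1, up + 1], hence the range of all nearby waves, strictly inside (-R,
  -- R).
  set R : ℝ := |um| + |up| + 2 with hR
  have hR0 : 0 < R := by positivity
  have hsub : ∀ v, um - 1 ≤ v → v ≤ up + 1 → v ∈ Set.Ioo (-R) R := fun v h1 h2 =>
    ⟨by linarith [neg_abs_le um, abs_nonneg up], by linarith [le_abs_self up, abs_nonneg um]⟩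
  obtain ⟨g, K, hg, hgf⟩ := exists_isTame_eqOn hf hR0
  have hgc := hg.contDiff.continuous
  have hg1 : ContDiff ℝ 1 g := hg.contDiff.of_le (by norm_num)
  have hf1 : ContDiff ℝ 1 f := hf.of_le (by norm_num)
  have hlt := hwell.lt
  have humR := hsub um (by linarith) (by linarith)
  have hupR := hsub up (by linarith) (by linarith)
  have hgw : IsPotentialWell g a E c um up := hwell.congr hf1.continuous hgc hR0 hgf
    (Set.Ioo_subset_Icc_self humR) (Set.Ioo_subset_Icc_self hupR)
  obtain ⟨u, p, -, -, hn, -, -⟩ := exists_newton_variation hg a c um 0 0 0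
  obtain ⟨τ, hτ, hpτ, hpos, huτ⟩ := hn.exists_half_period hgc hgw
  have hrange := hn.mem_Icc hg1 hτ hpos hpτ
  rw [huτ] at hrange
  have huR : ∀ x, u x ∈ Set.Ioo (-R) R := fun x =>
    hsub _ (by linarith [(hrange x).1]) (by linarith [(hrange x).2])
  have hnf : IsNewton f a c um u p :=
    hn.congr fun x => hgf _ (Set.Ioo_subset_Icc_self (huR x))
  have hm' : m ∈ Set.Ioo um (u τ) := by rwa [huτ]
  have hum := hnf.uMinus_eq hf1.continuous hτ hpos hwell.left_root hm'
  have hT := hnf.period_eq hf1.continuous hτ hpos hpτ hwell.left_root hm'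
  have hprof := hnf.profile_eq hf (hpos (τ / 2) ⟨by linarith, by linarith⟩).ne'
    hwell.left_root hum
  have hβ : 0 < a + c * um - f um := by linarith [hwell.left_deriv_neg hf1.continuous]
  have hgum : g um = f um := hgf _ (Set.Ioo_subset_Icc_self humR)
  have hgup : g up = f up := hgf _ (Set.Ioo_subset_Icc_self hupR)
  have hper := hn.periodic hg1 hpτ
  have hpT : p (2 * τ) = 0 := by
    have := hper.2 0
    rwa [zero_add, hn.p0] at this
  have huT : u (2 * τ) = um := by
    have := hper.1 0
    rwa [zero_add, hn.u0] at this
  refine ⟨p, a + c * um - f um, hβ, rfl, by rwa [hprof], by rw [hT]; positivity, by rwa [hT],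
    by rwa [hT, hprof], fun α e γ => ?_⟩
  rw [hprof, hT]
  obtain ⟨bt, hbt0, hbt, hbtE⟩ := exists_root_path hgc hgw.left_root rfl
    (by rw [hgum]; exact hβ.ne') α e γ
  obtain ⟨u', p', v, r, hn', hv, hv0⟩ := exists_newton_variation hg a c um α γ
    (-(e + α * um + γ / 2 * um ^ 2) / (a + c * um - g um))
  obtain ⟨rfl, rfl⟩ := IsNewton.eq_of_initial hg1 hn'.du hn'.dp hn.du hn.dp
    (hn'.u0.trans hn.u0.symm) (hn'.p0.trans hn.p0.symm)
  -- The truncated equation has a solution for every t. Only for small t is U t recognised as the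
  -- profile for f itself, in `hkey`.
  choose U P _ _ hU _ _ using fun t : ℝ =>
    exists_newton_variation hg (a + t * α) (c + t * γ) (bt t) 0 0 0
  have hU0' : IsNewton g a c um (U 0) (P 0) := by simpa [hbt0] using hU 0
  obtain ⟨hU0, hP0⟩ := IsNewton.eq_of_initial hg1 hU0'.du hU0'.dp hn.du hn.dp
    (hU0'.u0.trans hn.u0.symm) (hU0'.p0.trans hn.p0.symm)
  set L : ℝ := 2 * τ + 1 with hL
  obtain ⟨hDU, hDP⟩ := IsNewton.hasUniformDerivOn hg hU hbt (hU0 ▸ hv) hv0 L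
  have hvc : Continuous v := continuous_iff_continuousAt.2 fun x => (hv.dv x).continuousAt
  have hrc : Continuous r := continuous_iff_continuousAt.2 fun x => (hv.dr x).continuousAt
  obtain ⟨B, hBv, hBr, hBu⟩ : ∃ B, (∀ x ∈ Set.Icc 0 L, |v x| ≤ B) ∧
      (∀ x ∈ Set.Icc 0 L, |r x| ≤ B) ∧ (∀ x ∈ Set.Icc 0 L, |U 0 x| ≤ B) := by
    obtain ⟨B₁, h₁⟩ := isCompact_Icc.exists_bound_of_continuousOn (s := Set.Icc 0 L)
      hvc.continuousOn
    obtain ⟨B₂, h₂⟩ := isCompact_Icc.exists_bound_of_continuousOn (s := Set.Icc 0 L)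
      hrc.continuousOn
    obtain ⟨B₃, h₃⟩ := isCompact_Icc.exists_bound_of_continuousOn (s := Set.Icc 0 L)
      (hU 0).continuous_u.continuousOn
    exact ⟨max B₁ (max B₂ B₃), fun x hx => (h₁ x hx).trans (le_max_left _ _),
      fun x hx => (h₂ x hx).trans ((le_max_left _ _).trans (le_max_right _ _)),
      fun x hx => (h₃ x hx).trans ((le_max_right _ _).trans (le_max_right _ _))⟩
  have hB0 : 0 ≤ B := (abs_nonneg _).trans (hBv 0 ⟨le_rfl, by positivity⟩)
  have hK := hg.nonneg
  have hQ : ∀ ε > 0, ∀ᶠ t in 𝓝 (0 : ℝ), ∀ x ∈ Set.Icc 0 L,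
      |(a + t * α + (c + t * γ) * U t x - g (U t x))
        - (a + 0 * α + (c + 0 * γ) * U 0 x - g (U 0 x))| ≤ ε := by
    intro ε hε
    set C := |α| + |γ| * B + (|c| + |γ| + K) * (1 + B) with hC
    have h1 : Tendsto (fun t : ℝ => C * |t|) (𝓝 0) (𝓝 0) := by
      have : Continuous fun t : ℝ => C * |t| := by fun_prop
      simpa using this.tendsto 0
    filter_upwards [h1.eventually_le_const hε, hDU.abs_sub_le hBv,
      Icc_mem_nhds (show (-1 : ℝ) < 0 by norm_num) one_pos] with t ht hUt ht1 x hx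
    have ht1' : |t| ≤ 1 := abs_le.2 ht1
    refine le_trans ?_ ht
    rw [show (a + t * α + (c + t * γ) * U t x - g (U t x))
      - (a + 0 * α + (c + 0 * γ) * U 0 x - g (U 0 x))
      = t * (α + γ * U 0 x) + (c + t * γ) * (U t x - U 0 x) - (g (U t x) - g (U 0 x)) by ring]
    have e1 : |t * (α + γ * U 0 x)| ≤ |t| * (|α| + |γ| * B) := by
      rw [abs_mul]
      refine mul_le_mul_of_nonneg_left ((abs_add_le _ _).trans ?_) (abs_nonneg t)
      rw [abs_mul]
      exact add_le_add le_rfl (mul_le_mul_of_nonneg_left (hBu x hx) (abs_nonneg γ))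
    have e2 : |(c + t * γ) * (U t x - U 0 x)| ≤ (|c| + |γ|) * ((1 + B) * |t|) := by
      rw [abs_mul]
      refine mul_le_mul ((abs_add_le _ _).trans ?_) (hUt x hx) (abs_nonneg _) (by positivity)
      rw [abs_mul]
      have := mul_le_mul_of_nonneg_right ht1' (abs_nonneg γ)
      linarith
    have e3 : |g (U t x) - g (U 0 x)| ≤ K * ((1 + B) * |t|) :=
      (hg.abs_sub_le _ _).trans (mul_le_mul_of_nonneg_left (hUt x hx) hK)
    have e4 := abs_sub (t * (α + γ * U 0 x) + (c + t * γ) * (U t x - U 0 x))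
      (g (U t x) - g (U 0 x))
    have e5 := abs_add_le (t * (α + γ * U 0 x)) ((c + t * γ) * (U t x - U 0 x))
    have e6 : C * |t| = |t| * (|α| + |γ| * B) + (|c| + |γ|) * ((1 + B) * |t|)
        + K * ((1 + B) * |t|) := by rw [hC]; ring
    linarith
  set T : ℝ → ℝ := fun t => period f m (a + t * α) (E + t * e) (c + t * γ) with hTdef
  have hT0 : T 0 = 2 * τ := by simpa [hTdef] using hT
  obtain ⟨δ₀, hδ₀, hball⟩ : ∃ η > 0, ∀ x, |x - τ| < η → (m + up) / 2 < u' x := by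
    obtain ⟨η, hη, hb⟩ := Metric.eventually_nhds_iff.1
      ((hn.continuous_u.tendsto τ).eventually_const_lt
        (show (m + up) / 2 < u' τ by rw [huτ]; linarith [hm.2]))
    exact ⟨η, hη, fun v hv => hb (by rwa [Real.dist_eq])⟩
  -- The persisted half period y gives T t = 2y, a zero of P t near 2τ, where P 0 has slope β ≠ 0.
  -- That makes the period accessible to implicit differentiation. The tolerance on y is δ/2 because
  -- of the factor 2, and at most 1 so that y stays in [0, L].
  have hkey : ∀ δ > 0, ∀ᶠ t in 𝓝 (0 : ℝ), |T t - 2 * τ| < δ ∧ P t (T t) = 0 ∧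
      profile f m (a + t * α) (E + t * e) (c + t * γ) = U t := by
    intro δ hδ
    have hzero := eventually_exists_first_zero (P := P)
      (Q := fun t x => a + t * α + (c + t * γ) * U t x - g (U t x)) (τ := τ) (L := L)
      (fun t x => (hU t).dp x)
      (by have := (hU 0).continuous_u; fun_prop) (fun t => (hU t).p0)
      (by simp only [hU0, hn.u0, hgum]; linarith) hτ (by linarith)
      (by rwa [hP0]) (by rwa [hP0])
      (by
        have := hgw.right_deriv_pos hgc
        simp only [hU0, huτ]
        linarith)
      (fun ε hε => hDP.eventually_abs_sub_le hBr hε) hQ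
      (show 0 < min (min (δ / 2) δ₀) 1 by positivity)
    have hbtm : ∀ᶠ t in 𝓝 (0 : ℝ), bt t < m := by
      have := hbt.continuousAt.tendsto
      rw [hbt0] at this
      exact this.eventually_lt_const hm.1
    have hbtl : ∀ᶠ t in 𝓝 (0 : ℝ), um - 1 < bt t := by
      have := hbt.continuousAt.tendsto
      rw [hbt0] at this
      exact this.eventually_const_lt (by linarith)
    filter_upwards [hzero, hbtm, hbtl, hbtE,
      hDU.eventually_abs_sub_le hBv (show 0 < min ((up - m) / 2) 1 by
        have := hm.2
        exact lt_min (by linarith) one_pos)] with t ⟨y, hy, hy0, hPy, hPpos⟩ h1 h2 h3 h4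
    simp only [lt_min_iff] at hy
    have hyL : y ∈ Set.Icc 0 L := ⟨hy0.le, by linarith [(abs_lt.1 hy.2).2]⟩
    have hUy := (h4 y hyL)
    rw [hU0, le_min_iff] at hUy
    have h5 : m < U t y := by
      have := hball y hy.1.2
      linarith [(abs_le.1 hUy.1).1]
    have h6 : U t y ≤ up + 1 := by
      linarith [(abs_le.1 hUy.2).2, (hrange y).2]
    have hmt : m ∈ Set.Ioo (bt t) (U t y) := ⟨h1, h5⟩
    have hrt := (hU t).mem_Icc hg1 hy0 hPpos hPy
    have hUf : IsNewton f (a + t * α) (c + t * γ) (bt t) (U t) (P t) :=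
      (hU t).congr fun x => hgf _ (Set.Ioo_subset_Icc_self
        (hsub _ (h2.le.trans (hrt x).1) ((hrt x).2.trans h6)))
    have hEt : potential f (a + t * α) (c + t * γ) (bt t) = E + t * e := by
      rw [← h3]
      exact (potential_congr hR0 hgf _ _ (Set.Ioo_subset_Icc_self
        (hsub _ h2.le (by linarith [hm.2])))).symm
    have hTt : T t = 2 * y := hUf.period_eq hf1.continuous hy0 hPpos hPy hEt hmt
    refine ⟨?_, ?_, ?_⟩
    · rw [hTt, ← mul_sub, abs_mul, abs_two]
      linarith [hy.1.1]
    · have := ((hU t).periodic hg1 hPy).2 0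
      rwa [zero_add, (hU t).p0, ← hTt] at this
    · exact hUf.profile_eq hf (hPpos (y / 2) ⟨by linarith, by linarith⟩).ne' hEt
        (hUf.uMinus_eq hf1.continuous hy0 hPpos hEt hmt)
  have hTt : Tendsto T (𝓝 0) (𝓝 (2 * τ)) := Metric.tendsto_nhds.2 fun δ hδ => by
    filter_upwards [hkey δ hδ] with t ht
    rw [Real.dist_eq]
    exact ht.1
  have hdp : HasDerivAt (P 0) (a + c * um - f um) (2 * τ) := by
    rw [hP0]
    refine (hn.dp (2 * τ)).congr_deriv ?_
    rw [huT, hgum]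
  have h2τ : 2 * τ ∈ Set.Ioo 0 L := ⟨by positivity, by linarith⟩
  have hTd : HasDerivAt T (-r (2 * τ) / (a + c * um - f um)) 0 :=
    hDP.hasDerivAt_root (Icc_mem_nhds h2τ.1 h2τ.2) hdp hβ.ne' hrc.continuousAt hTt hT0
      ((hkey 1 one_pos).mono fun t ht => ht.2.1)
  -- Equality of derivatives needs agreement on a neighbourhood, hence the range of u' in the open
  -- interval.
  have hdg : ∀ x, deriv g (u' x) = deriv f (u' x) := fun x =>
    Filter.EventuallyEq.deriv_eq (by
      filter_upwards [Ioo_mem_nhds (huR x).1 (huR x).2] with y hy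
      exact hgf y (Set.Ioo_subset_Icc_self hy))
  have hum0 : U 0 (2 * τ) = um := by rw [hU0, huT]
  refine ⟨v, r, -r (2 * τ) / (a + c * um - f um), ⟨hv.dv, fun x => hdg x ▸ hv.dr x, hv.r0⟩,
    by rw [hv0, hgum], by field_simp, hTd, ?_, ?_⟩
  · have := hDU.hasDerivAt_integral (fun t => (hU t).continuous_u) hvc hTd hT0 h2τ
    rw [hum0] at this
    refine this.congr_of_eventuallyEq ?_
    filter_upwards [hkey 1 one_pos] with t ht
    rw [mass, ht.2.2]
  · have := (hDU.sq hBv hBu).hasDerivAt_integral (fun t => (hU t).continuous_u.pow 2)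
      ((continuous_const.mul (hU 0).continuous_u).mul hvc) hTd hT0 h2τ
    rw [hum0, hU0] at this
    refine this.congr_of_eventuallyEq ?_
    filter_upwards [hkey 1 one_pos] with t ht
    rw [momentum, ht.2.2]

/-! ### Approximate solutions of the spectral problem and its two conserved quantities. -/

/-- `(w 0, w 1, w 2)` solves `Y_x = H(x, μ) Y + (0, 0, ρ)`, where `H` is the coefficient matrix of
the linearization about `u` and `p = u_x`. -/
structure IsApproxSolution (f : ℝ → ℝ) (c : ℝ) (u p : ℝ → ℝ) (μ : ℂ) (w : ℝ → Fin 3 → ℂ)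
    (ρ : ℝ → ℂ) : Prop where
  d0 : ∀ x, HasDerivAt (fun y => w y 0) (w x 1) x
  d1 : ∀ x, HasDerivAt (fun y => w y 1) (w x 2) x
  d2 : ∀ x, HasDerivAt (fun y => w y 2)
    ((-μ - ((deriv (deriv f) (u x) * p x : ℝ) : ℂ)) * w x 0 + ((c - deriv f (u x) : ℝ) : ℂ) * w x 1
      + ρ x) x

namespace IsApproxSolution

variable {f : ℝ → ℝ} {a c b : ℝ} {u p : ℝ → ℝ} {μ : ℂ} {w w' : ℝ → Fin 3 → ℂ} {ρ ρ' : ℝ → ℂ}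

theorem sub (h : IsApproxSolution f c u p μ w ρ) (h' : IsApproxSolution f c u p μ w' ρ') :
    IsApproxSolution f c u p μ (fun x => w x - w' x) (fun x => ρ x - ρ' x) :=
  ⟨fun x => (h.d0 x).sub (h'.d0 x), fun x => (h.d1 x).sub (h'.d1 x), fun x =>
    ((h.d2 x).sub (h'.d2 x)).congr_deriv (by simp only [Pi.sub_apply]; ring)⟩

theorem continuous_zero (h : IsApproxSolution f c u p μ w ρ) : Continuous fun x => w x 0 :=
  continuous_iff_continuousAt.2 fun x => (h.d0 x).continuousAt

/-- Solutions with zero initial value are bounded by the inhomogeneity. -/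
theorem exists_norm_le (hf : ContDiff ℝ 2 f) (hu : Continuous u) (hp : Continuous p) (c T : ℝ) :
    ∃ C, 0 ≤ C ∧ ∀ (μ : ℂ) (w : ℝ → Fin 3 → ℂ) (ρ : ℝ → ℂ) (δ : ℝ), ‖μ‖ ≤ 1 → 0 ≤ δ →
      IsApproxSolution f c u p μ w ρ → w 0 = 0 → (∀ x ∈ Set.Icc 0 T, ‖ρ x‖ ≤ δ) →
      ∀ x ∈ Set.Icc 0 T, ‖w x‖ ≤ C * δ := by
  have hf1 := contDiff_one_deriv hf
  have hcf2 : Continuous (deriv (deriv f)) := hf1.continuous_deriv le_rfl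
  have hcf1 : Continuous (deriv f) := hf1.continuous
  obtain ⟨K₁, hK₁⟩ := isCompact_Icc.exists_bound_of_continuousOn (s := Set.Icc 0 T)
    (f := fun x => deriv (deriv f) (u x) * p x) (by fun_prop)
  obtain ⟨K₂, hK₂⟩ := isCompact_Icc.exists_bound_of_continuousOn (s := Set.Icc 0 T)
    (f := fun x => c - deriv f (u x)) (by fun_prop)
  refine ⟨Real.exp ((1 + |K₁| + |K₂|) * T), (Real.exp_pos _).le, ?_⟩
  intro μ w ρ δ hμ hδ hw h0 hρ x hx
  have hcomp : ∀ x i, ‖w x i‖ ≤ ‖w x‖ := fun x i => norm_le_pi_norm (w x) i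
  have key := norm_le_mul_exp_of_norm_deriv_le (Z := w) (δ := 0) (ε := δ) (L := T)
    (Z' := fun x => ![w x 1, w x 2,
      (-μ - ((deriv (deriv f) (u x) * p x : ℝ) : ℂ)) * w x 0
        + ((c - deriv f (u x) : ℝ) : ℂ) * w x 1 + ρ x])
    (K := 1 + |K₁| + |K₂|) (by have := abs_nonneg K₁; have := abs_nonneg K₂; linarith) le_rfl hδ
    (fun x => by
      rw [hasDerivAt_pi]
      intro i
      fin_cases i
      · exact hw.d0 x
      · exact hw.d1 x
      · exact hw.d2 x) (by rw [h0, norm_zero])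
    (fun x hx => by
      have hN := norm_nonneg (w x)
      have hK1 := mul_nonneg (abs_nonneg K₁) hN
      have hK2 := mul_nonneg (abs_nonneg K₂) hN
      rw [pi_norm_le_iff_of_nonneg (by positivity)]
      intro i
      fin_cases i
      · have := hcomp x 1
        simp only [Fin.zero_eta, Matrix.cons_val_zero]
        linarith
      · have := hcomp x 2
        simp only [Fin.mk_one, Matrix.cons_val_one, Matrix.cons_val_zero]
        linarith
      · change ‖(-μ - ((deriv (deriv f) (u x) * p x : ℝ) : ℂ)) * w x 0
          + ((c - deriv f (u x) : ℝ) : ℂ) * w x 1 + ρ x‖ ≤ _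
        have e1 : ‖(-μ - ((deriv (deriv f) (u x) * p x : ℝ) : ℂ)) * w x 0‖
            ≤ (1 + |K₁|) * ‖w x‖ := by
          rw [norm_mul]
          refine mul_le_mul ((norm_sub_le _ _).trans (add_le_add ?_ ?_)) (hcomp x 0)
            (norm_nonneg _) (by positivity)
          · rwa [norm_neg]
          · rw [Complex.norm_real]
            exact (hK₁ x hx).trans (le_abs_self _)
        have e2 : ‖((c - deriv f (u x) : ℝ) : ℂ) * w x 1‖ ≤ |K₂| * ‖w x‖ := by
          rw [norm_mul, Complex.norm_real]
          exact mul_le_mul ((hK₂ x hx).trans (le_abs_self _)) (hcomp x 1)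
            (norm_nonneg _) (by positivity)
        have e3 := norm_add₃_le (a := (-μ - ((deriv (deriv f) (u x) * p x : ℝ) : ℂ)) * w x 0)
          (b := ((c - deriv f (u x) : ℝ) : ℂ) * w x 1) (c := ρ x)
        have e4 := hρ x hx
        linarith) x hx
  rw [zero_add, mul_comm] at key
  exact key

/-- The first conserved quantity: `L v = (c - f'(u)) v - v''` satisfies `∂ₓ L v = μ v`. -/
theorem integral_eq_first (hf : ContDiff ℝ 2 f) (hN : IsNewton f a c b u p)
    (h : IsApproxSolution f c u p μ w 0) (T : ℝ) :
    (((c - deriv f (u T) : ℝ) : ℂ) * w T 0 - w T 2)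
      - (((c - deriv f (u 0) : ℝ) : ℂ) * w 0 0 - w 0 2)
      = μ * ∫ x in (0 : ℝ)..T, w x 0 := by
  have hdf : ∀ x, HasDerivAt (deriv f) (deriv (deriv f) x) x := fun x =>
    ((contDiff_one_deriv hf).differentiable (by norm_num) x).hasDerivAt
  rw [← intervalIntegral.integral_const_mul]
  refine (intervalIntegral.integral_eq_sub_of_hasDerivAt
    (f := fun x => ((c - deriv f (u x) : ℝ) : ℂ) * w x 0 - w x 2) (fun x _ => ?_)
    ((h.continuous_zero.const_mul μ).intervalIntegrable _ _)).symm
  have h1 : HasDerivAt (fun x => ((c - deriv f (u x) : ℝ) : ℂ))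
      ((-(deriv (deriv f) (u x) * p x) : ℝ) : ℂ) x :=
    (((hdf (u x)).comp x (hN.du x)).const_sub c).ofReal_comp
  refine ((h1.mul (h.d0 x)).sub (h.d2 x)).congr_deriv ?_
  simp only [Pi.zero_apply]
  push_cast
  ring

/-- The second conserved quantity: `u L v + u' v' - u'' v` has derivative `μ u v`. -/
theorem integral_eq_second (hf : ContDiff ℝ 2 f) (hN : IsNewton f a c b u p)
    (h : IsApproxSolution f c u p μ w 0) (T : ℝ) :
    ((u T : ℂ) * (((c - deriv f (u T) : ℝ) : ℂ) * w T 0 - w T 2) + p T * w T 1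
        - ((a + c * u T - f (u T) : ℝ) : ℂ) * w T 0)
      - ((u 0 : ℂ) * (((c - deriv f (u 0) : ℝ) : ℂ) * w 0 0 - w 0 2) + p 0 * w 0 1
        - ((a + c * u 0 - f (u 0) : ℝ) : ℂ) * w 0 0)
      = μ * ∫ x in (0 : ℝ)..T, (u x : ℂ) * w x 0 := by
  have hf1 : ContDiff ℝ 1 f := hf.of_le (by norm_num)
  have hd0 : ∀ x, HasDerivAt f (deriv f x) x := fun x =>
    (hf1.differentiable (by norm_num) x).hasDerivAt
  have hdf : ∀ x, HasDerivAt (deriv f) (deriv (deriv f) x) x := fun x =>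
    ((contDiff_one_deriv hf).differentiable (by norm_num) x).hasDerivAt
  have huc : Continuous fun x => (u x : ℂ) := Complex.continuous_ofReal.comp hN.continuous_u
  rw [← intervalIntegral.integral_const_mul]
  have hc : Continuous fun x => μ * ((u x : ℂ) * w x 0) := (huc.mul h.continuous_zero).const_mul μ
  refine (intervalIntegral.integral_eq_sub_of_hasDerivAt
    (f := fun x => (u x : ℂ) * (((c - deriv f (u x) : ℝ) : ℂ) * w x 0 - w x 2) + p x * w x 1
      - ((a + c * u x - f (u x) : ℝ) : ℂ) * w x 0) (fun x _ => ?_)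
    (hc.intervalIntegrable _ _)).symm
  have h1 : HasDerivAt (fun x => ((c - deriv f (u x) : ℝ) : ℂ))
      ((-(deriv (deriv f) (u x) * p x) : ℝ) : ℂ) x :=
    (((hdf (u x)).comp x (hN.du x)).const_sub c).ofReal_comp
  have h2 : HasDerivAt (fun x => ((a + c * u x - f (u x) : ℝ) : ℂ))
      ((c * p x - deriv f (u x) * p x : ℝ) : ℂ) x :=
    ((((hN.du x).const_mul c).const_add a).sub ((hd0 (u x)).comp x (hN.du x))).ofReal_comp
  refine ((((hN.du x).ofReal_comp.mul ((h1.mul (h.d0 x)).sub (h.d2 x))).add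
    ((hN.dp x).ofReal_comp.mul (h.d1 x))).sub (h2.mul (h.d0 x))).congr_deriv ?_
  simp only [Pi.zero_apply, Pi.sub_apply, Pi.mul_apply]
  push_cast
  ring

end IsApproxSolution

theorem IsFundamentalMatrix.isApproxSolution {f : ℝ → ℝ} {c : ℝ} {u p : ℝ → ℝ}
    {Φ : ℝ → ℂ → Matrix (Fin 3) (Fin 3) ℂ} (hΦ : IsFundamentalMatrix (systemMatrix f c u) Φ)
    (hp : ∀ x, deriv u x = p x) (μ : ℂ) (w₀ : Fin 3 → ℂ) :
    IsApproxSolution f c u p μ (fun x => (Φ x μ).mulVec w₀) 0 := by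
  have hd : ∀ x i, HasDerivAt (fun y => (Φ y μ).mulVec w₀ i)
      ((systemMatrix f c u μ x).mulVec ((Φ x μ).mulVec w₀) i) x := fun x i => by
    rw [Matrix.mulVec_mulVec]
    simp only [Matrix.mulVec, dotProduct]
    exact HasDerivAt.fun_sum fun j _ => ((hΦ μ).2 x i j).mul_const (w₀ j)
  refine ⟨fun x => (hd x 0).congr_deriv ?_, fun x => (hd x 1).congr_deriv ?_,
    fun x => (hd x 2).congr_deriv ?_⟩
  · generalize (Φ x μ).mulVec w₀ = y
    simp [systemMatrix, Matrix.mulVec, dotProduct, Fin.sum_univ_three]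
  · generalize (Φ x μ).mulVec w₀ = y
    simp [systemMatrix, Matrix.mulVec, dotProduct, Fin.sum_univ_three]
  · rw [← hp x]
    generalize (Φ x μ).mulVec w₀ = y
    simp [systemMatrix, Matrix.mulVec, dotProduct, Fin.sum_univ_three]

/-- The boundary functionals at `x = 0, T` of the conserved quantities, and evaluation of `v'`. -/
def boundaryMatrix (d b β : ℝ) : Matrix (Fin 3) (Fin 3) ℂ :=
  !![(d : ℂ), 0, -1; (b * d - β : ℝ), 0, -(b : ℂ); 0, 1, 0]

/-- Leading order of the image of an approximate solution under the boundary functionals. -/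
theorem exists_boundary_estimate {f : ℝ → ℝ} (hf : ContDiff ℝ 2 f) {a c b T : ℝ}
    {u p : ℝ → ℝ} (hN : IsNewton f a c b u p) (hT : 0 < T) (huT : u T = b) (hpT : p T = 0)
    {Φ : ℝ → ℂ → Matrix (Fin 3) (Fin 3) ℂ} (hΦ : IsFundamentalMatrix (systemMatrix f c u) Φ) :
    ∃ C, ∀ (μ : ℂ) (w : ℝ → Fin 3 → ℂ) (ρ : ℝ → ℂ) (δ : ℝ), ‖μ‖ ≤ 1 → 0 ≤ δ →
      IsApproxSolution f c u p μ w ρ → (∀ x ∈ Set.Icc 0 T, ‖ρ x‖ ≤ δ) →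
      let R := boundaryMatrix (c - deriv f b) b (a + c * b - f b)
      let z := (Φ T μ).mulVec (w 0)
      ‖R.mulVec z 0 - R.mulVec (w 0) 0 - μ * ∫ x in (0 : ℝ)..T, w x 0‖ ≤ C * (‖μ‖ * δ) ∧
      ‖R.mulVec z 1 - R.mulVec (w 0) 1 - μ * ∫ x in (0 : ℝ)..T, (u x : ℂ) * w x 0‖
        ≤ C * (‖μ‖ * δ) ∧
      ‖R.mulVec z 2 - w T 1‖ ≤ C * δ := by
  obtain ⟨C, hC0, hC⟩ := IsApproxSolution.exists_norm_le hf hN.continuous_u hN.continuous_p c T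
  obtain ⟨B, hB⟩ := isCompact_Icc.exists_bound_of_continuousOn (s := Set.Icc 0 T)
    hN.continuous_u.continuousOn
  have huc : Continuous fun x => (u x : ℂ) := Complex.continuous_ofReal.comp hN.continuous_u
  refine ⟨C + C * T + |B| * C * T, fun μ w ρ δ hμ hδ hw hρ => ?_⟩
  intro R z
  have hs := hΦ.isApproxSolution (fun x => (hN.du x).deriv) μ (w 0)
  have hdiff := hC μ _ _ δ hμ hδ (hs.sub hw) (by simp [(hΦ μ).1]) (by simpa using hρ)
  have hcomp : ∀ x ∈ Set.Icc 0 T, ∀ i, ‖(Φ x μ).mulVec (w 0) i - w x i‖ ≤ C * δ :=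
    fun x hx i => (norm_le_pi_norm ((Φ x μ).mulVec (w 0) - w x) i).trans (hdiff x hx)
  -- The identities `h1` and `h2` are exact for the true solution with initial value w(0). Replacing
  -- it by w happens only under μ∫, so these two errors carry an additional factor ‖μ‖; the third
  -- row has no such gain.
  have h1 := hs.integral_eq_first hf hN T
  have h2 := hs.integral_eq_second hf hN T
  simp only [(hΦ μ).1, Matrix.one_mulVec, huT, hN.u0, hpT, hN.p0] at h1 h2
  have hR0 : ∀ y : Fin 3 → ℂ, R.mulVec y 0 = ((c - deriv f b : ℝ) : ℂ) * y 0 - y 2 := fun y => by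
    simp [R, boundaryMatrix, Matrix.mulVec, dotProduct, Fin.sum_univ_three]
    ring
  have hR1 : ∀ y : Fin 3 → ℂ, R.mulVec y 1 = (b : ℂ) * (((c - deriv f b : ℝ) : ℂ) * y 0 - y 2)
      + (0 : ℝ) * y 1 - ((a + c * b - f b : ℝ) : ℂ) * y 0 := fun y => by
    simp [R, boundaryMatrix, Matrix.mulVec, dotProduct, Fin.sum_univ_three]
    ring
  have hR2 : ∀ y : Fin 3 → ℂ, R.mulVec y 2 = y 1 := fun y => by
    simp [R, boundaryMatrix, Matrix.mulVec, dotProduct, Fin.sum_univ_three]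
  have hTm : T ∈ Set.Icc 0 T := ⟨hT.le, le_rfl⟩
  have hCδ : 0 ≤ C * δ := by positivity
  refine ⟨?_, ?_, ?_⟩
  · rw [hR0, hR0, h1, ← mul_sub, ← intervalIntegral.integral_sub
      (hs.continuous_zero.intervalIntegrable _ _) (hw.continuous_zero.intervalIntegrable _ _),
      norm_mul]
    have h3 := intervalIntegral.norm_integral_le_of_norm_le_const (a := 0) (b := T)
      (f := fun x => (Φ x μ).mulVec (w 0) 0 - w x 0) (C := C * δ) (fun x hx => by
        rw [Set.uIoc_of_le hT.le] at hx
        exact hcomp x ⟨hx.1.le, hx.2⟩ 0)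
    rw [sub_zero, abs_of_pos hT] at h3
    calc _ ≤ ‖μ‖ * (C * δ * T) := mul_le_mul_of_nonneg_left h3 (norm_nonneg _)
      _ = C * T * (‖μ‖ * δ) := by ring
      _ ≤ _ := by
        refine mul_le_mul_of_nonneg_right ?_ (by positivity)
        have : 0 ≤ |B| * C * T := by positivity
        linarith
  · have hc1 : Continuous fun x => (u x : ℂ) * (Φ x μ).mulVec (w 0) 0 := huc.mul hs.continuous_zero
    have hc2 : Continuous fun x => (u x : ℂ) * w x 0 := huc.mul hw.continuous_zero
    rw [hR1, hR1, h2, ← mul_sub, ← intervalIntegral.integral_sub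
      (hc1.intervalIntegrable _ _) (hc2.intervalIntegrable _ _), norm_mul]
    have h3 := intervalIntegral.norm_integral_le_of_norm_le_const (a := 0) (b := T)
      (f := fun x => (u x : ℂ) * (Φ x μ).mulVec (w 0) 0 - (u x : ℂ) * w x 0)
      (C := |B| * (C * δ)) (fun x hx => by
        rw [Set.uIoc_of_le hT.le] at hx
        rw [← mul_sub, norm_mul, Complex.norm_real]
        exact mul_le_mul ((hB x ⟨hx.1.le, hx.2⟩).trans (le_abs_self B))
          (hcomp x ⟨hx.1.le, hx.2⟩ 0) (norm_nonneg _) (abs_nonneg _))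
    rw [sub_zero, abs_of_pos hT] at h3
    calc _ ≤ ‖μ‖ * (|B| * (C * δ) * T) := mul_le_mul_of_nonneg_left h3 (norm_nonneg _)
      _ = |B| * C * T * (‖μ‖ * δ) := by ring
      _ ≤ _ := by
        refine mul_le_mul_of_nonneg_right ?_ (by positivity)
        have : 0 ≤ C * T := by positivity
        linarith
  · rw [hR2]
    refine (hcomp T hTm 1).trans (mul_le_mul_of_nonneg_right ?_ hδ)
    have : 0 ≤ C * T := by positivity
    have : 0 ≤ |B| * C * T := by positivity
    linarith

/-! ### Expansion of the Evans function at the origin. -/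

/-- Perturbation of the determinant of a matrix whose entries in the first two rows and in the first
column carry one extra power of `r`. -/
theorem isBigO_det_sub {X : Type*} {l : Filter X} {r : X → ℝ} (hr : r =O[l] fun _ => (1 : ℝ))
    {A Λ : X → Matrix (Fin 3) (Fin 3) ℂ} (k j : Fin 3 → ℕ)
    (hA : ∀ i i', (fun x => A x i i' - Λ x i i') =O[l] fun x => r x ^ (k i + j i' + 1))
    (hΛ : ∀ i i', (fun x => Λ x i i') =O[l] fun x => r x ^ (k i + j i')) :
    (fun x => (A x).det - (Λ x).det) =O[l]
      fun x => r x ^ (k 0 + k 1 + k 2 + (j 0 + j 1 + j 2) + 1) := by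
  have hA' : ∀ i i', (fun x => A x i i') =O[l] fun x => r x ^ (k i + j i') := fun i i' => by
    have h1 : (fun x => r x ^ (k i + j i' + 1)) =O[l] fun x => r x ^ (k i + j i') := by
      have := (isBigO_refl (fun x => r x ^ (k i + j i')) l).mul hr
      simpa [pow_succ] using this
    exact (((hA i i').trans h1).add (hΛ i i')).congr_left fun x => by ring
  -- Each product in the determinant uses every row and column once, so its weights always add up to
  -- the same total. Replacing the factors one at a time leaves a difference in one factor, which
  -- contributes the extra power of r.
  have triple : ∀ a b c : Fin 3, j a + j b + j c = j 0 + j 1 + j 2 →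
      (fun x => A x 0 a * A x 1 b * A x 2 c - Λ x 0 a * Λ x 1 b * Λ x 2 c) =O[l]
        fun x => r x ^ (k 0 + k 1 + k 2 + (j 0 + j 1 + j 2) + 1) := fun a b c habc => by
    have h1 := ((hA 0 a).mul (hA' 1 b)).mul (hA' 2 c)
    have h2 := ((hΛ 0 a).mul (hA 1 b)).mul (hA' 2 c)
    have h3 := ((hΛ 0 a).mul (hΛ 1 b)).mul (hA 2 c)
    simp only [← pow_add] at h1 h2 h3
    rw [show k 0 + j a + 1 + (k 1 + j b) + (k 2 + j c)
      = k 0 + k 1 + k 2 + (j 0 + j 1 + j 2) + 1 by omega] at h1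
    rw [show k 0 + j a + (k 1 + j b + 1) + (k 2 + j c)
      = k 0 + k 1 + k 2 + (j 0 + j 1 + j 2) + 1 by omega] at h2
    rw [show k 0 + j a + (k 1 + j b) + (k 2 + j c + 1)
      = k 0 + k 1 + k 2 + (j 0 + j 1 + j 2) + 1 by omega] at h3
    exact ((h1.add h2).add h3).congr_left fun x => by ring
  have := (((((triple 0 1 2 rfl).sub (triple 0 2 1 (by ring))).sub (triple 1 0 2 (by ring))).add
    (triple 1 2 0 (by ring))).add (triple 2 0 1 (by ring))).sub (triple 2 1 0 (by ring))
  refine this.congr_left fun x => ?_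
  rw [Matrix.det_fin_three, Matrix.det_fin_three]
  ring

namespace IsApproxSolution

variable {f : ℝ → ℝ} {a c b α γ : ℝ} {u p v r : ℝ → ℝ}

theorem add_smul {μ : ℂ} {w w' : ℝ → Fin 3 → ℂ} {ρ ρ' : ℝ → ℂ}
    (h : IsApproxSolution f c u p μ w ρ) (h' : IsApproxSolution f c u p μ w' ρ') (k : ℂ) :
    IsApproxSolution f c u p μ (fun x => w x + k • w' x) (fun x => ρ x + k * ρ' x) :=
  ⟨fun x => (h.d0 x).add ((h'.d0 x).const_mul k), fun x => (h.d1 x).add ((h'.d1 x).const_mul k),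
    fun x => ((h.d2 x).add ((h'.d2 x).const_mul k)).congr_deriv (by
      simp only [Pi.add_apply, Pi.smul_apply, smul_eq_mul]; ring)⟩

/-- The linearized equation says Lv = -α - γu, so ∂ₓLv = -γu_x; comparison with μv leaves the
residual γu_x + μv. -/
theorem of_isVariation (hf : ContDiff ℝ 2 f) (hN : IsNewton f a c b u p)
    (hv : IsVariation f c α γ u v r) (μ : ℂ) :
    IsApproxSolution f c u p μ
      (fun x => ![(v x : ℂ), r x, (α + γ * u x + (c - deriv f (u x)) * v x : ℝ)])
      (fun x => γ * p x + μ * v x) := by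
  have hdf : ∀ x, HasDerivAt (deriv f) (deriv (deriv f) x) x := fun x =>
    ((contDiff_one_deriv hf).differentiable (by norm_num) x).hasDerivAt
  refine ⟨fun x => (hv.dv x).ofReal_comp, fun x => (hv.dr x).ofReal_comp, fun x => ?_⟩
  have := ((((hN.du x).const_mul γ).const_add α).add
    ((((hdf (u x)).comp x (hN.du x)).const_sub c).mul (hv.dv x))).ofReal_comp
  refine this.congr_deriv ?_
  simp
  ring

/-- The translation mode: Lu_x = 0, so the whole of μu_x is residual. -/
theorem of_isNewton (hf : ContDiff ℝ 2 f) (hN : IsNewton f a c b u p) (μ : ℂ) :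
    IsApproxSolution f c u p μ
      (fun x => ![(p x : ℂ), (a + c * u x - f (u x) : ℝ), ((c - deriv f (u x)) * p x : ℝ)])
      (fun x => μ * p x) := by
  have hf1 : ContDiff ℝ 1 f := hf.of_le (by norm_num)
  have hd0 : ∀ x, HasDerivAt f (deriv f x) x := fun x =>
    (hf1.differentiable (by norm_num) x).hasDerivAt
  have hdf : ∀ x, HasDerivAt (deriv f) (deriv (deriv f) x) x := fun x =>
    ((contDiff_one_deriv hf).differentiable (by norm_num) x).hasDerivAt
  refine ⟨fun x => (hN.dp x).ofReal_comp, fun x => ?_, fun x => ?_⟩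
  · have := ((((hN.du x).const_mul c).const_add a).sub ((hd0 (u x)).comp x (hN.du x))).ofReal_comp
    refine this.congr_deriv ?_
    simp
    ring
  · have := ((((hdf (u x)).comp x (hN.du x)).const_sub c).mul (hN.dp x)).ofReal_comp
    refine this.congr_deriv ?_
    simp
    ring

end IsApproxSolution

theorem norm_add_abs_pow_four_isBigO (l : Filter (ℂ × ℝ)) :
    (fun q : ℂ × ℝ => (‖q.1‖ + |q.2|) ^ 4) =O[l] fun q => ‖q.1‖ ^ 4 + q.2 ^ 4 := by
  refine IsBigO.of_bound 8 (Eventually.of_forall fun q => ?_)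
  have h := add_pow_le (norm_nonneg q.1) (abs_nonneg q.2) 4
  have h2 : |q.2| ^ 4 = q.2 ^ 4 := by
    rw [← abs_pow, abs_of_nonneg (by positivity)]
  rw [h2] at h
  rw [Real.norm_of_nonneg (by positivity), Real.norm_of_nonneg (by positivity)]
  norm_num at h
  exact h

/-- The leading order expansion of the periodic Evans function at the origin, in terms of solutions
`v` of the linearized profile equation, the variations of the wave in `a`, `E` and `s = -c`. -/
theorem evansFunction_expansion {f : ℝ → ℝ} (hf : ContDiff ℝ 2 f) {a c b T β : ℝ} {u p : ℝ → ℝ}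
    (hN : IsNewton f a c b u p) (hT : 0 < T) (huT : u T = b) (hpT : p T = 0)
    (hβ : β = a + c * b - f b) (hβ0 : β ≠ 0)
    {va ra vE rE vs rs : ℝ → ℝ} (ha : IsVariation f c 1 0 u va ra)
    (hE : IsVariation f c 0 0 u vE rE) (hs : IsVariation f c 0 (-1) u vs rs)
    (ha0 : va 0 = -b / β) (hE0 : vE 0 = -1 / β) (hs0 : vs 0 = b ^ 2 / (2 * β))
    {Ta TE Ts : ℝ} (haT : ra T = -Ta * β) (hET : rE T = -TE * β) (hsT : rs T = -Ts * β)
    {Φ : ℝ → ℂ → Matrix (Fin 3) (Fin 3) ℂ} (hΦ : IsFundamentalMatrix (systemMatrix f c u) Φ)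
    {Ia IE Is Ja JE Js : ℝ} (hIa : ∫ x in (0 : ℝ)..T, va x = Ia) (hIE : ∫ x in (0 : ℝ)..T, vE x = IE)
    (hIs : ∫ x in (0 : ℝ)..T, vs x = Is) (hJa : ∫ x in (0 : ℝ)..T, u x * va x = Ja)
    (hJE : ∫ x in (0 : ℝ)..T, u x * vE x = JE) (hJs : ∫ x in (0 : ℝ)..T, u x * vs x = Js) :
    (fun q : ℂ × ℝ => evansFunction Φ T q.1 q.2 - (-1 / (β : ℂ)) *
      (!![q.1 ^ 2 * Is - Complex.I * q.2 * q.1 * b, q.1 * Ia + Complex.I * q.2, q.1 * IE;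
        q.1 ^ 2 * Js - Complex.I * q.2 * q.1 * b ^ 2 / 2, q.1 * Ja, q.1 * JE - Complex.I * q.2;
        -q.1 * Ts * β - Complex.I * q.2 * β, -Ta * β, -TE * β] : Matrix (Fin 3) (Fin 3) ℂ).det)
      =O[𝓝 ((0 : ℂ), (0 : ℝ))] fun q : ℂ × ℝ => ‖q.1‖ ^ 4 + q.2 ^ 4 := by
  set l := 𝓝 ((0 : ℂ), (0 : ℝ)) with hl
  set r : ℂ × ℝ → ℝ := fun q => ‖q.1‖ + |q.2| with hr
  have hr0 : ∀ q, 0 ≤ r q := fun q => by positivity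
  have hrt : Tendsto r l (𝓝 0) := by
    have : Continuous r := by fun_prop
    simpa [hr] using this.tendsto (0, 0)
  have hr1 : r =O[l] fun _ => (1 : ℝ) := hrt.isBigO_one ℝ
  have hμr : (fun q : ℂ × ℝ => q.1) =O[l] r := IsBigO.of_bound 1 (Eventually.of_forall fun q => by
    rw [one_mul, Real.norm_of_nonneg (hr0 q)]
    exact le_add_of_nonneg_right (abs_nonneg _))
  have hκr : (fun q : ℂ × ℝ => (q.2 : ℂ)) =O[l] r :=
    IsBigO.of_bound 1 (Eventually.of_forall fun q => by
      rw [one_mul, Real.norm_of_nonneg (hr0 q), Complex.norm_real]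
      exact le_add_of_nonneg_left (norm_nonneg _))
  have hσr : (fun q : ℂ × ℝ => Complex.I * q.2) =O[l] r := hκr.const_mul_left _
  have hμ1 : ∀ᶠ q : ℂ × ℝ in l, ‖q.1‖ ≤ 1 := by
    filter_upwards [hrt.eventually_le_const one_pos] with q hq
    exact (le_add_of_nonneg_right (abs_nonneg _)).trans hq
  have he2 : (fun q : ℂ × ℝ => Complex.exp (Complex.I * q.2) - 1 - Complex.I * q.2)
      =O[l] fun q => r q ^ 2 := by
    refine IsBigO.of_bound 1 ?_
    filter_upwards [hrt.eventually_le_const one_pos] with q hq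
    have hn : ‖Complex.I * q.2‖ = |q.2| := by simp
    have hle : |q.2| ≤ r q := le_add_of_nonneg_left (norm_nonneg _)
    have h1 := Complex.norm_exp_sub_one_sub_id_le (x := Complex.I * q.2) (by
      rw [hn]; exact hle.trans hq)
    rw [hn] at h1
    rw [one_mul, Real.norm_of_nonneg (by positivity)]
    exact h1.trans (pow_le_pow_left₀ (abs_nonneg _) hle 2)
  obtain ⟨C, hC⟩ := exists_boundary_estimate hf hN hT huT hpT hΦ
  rw [← hβ] at hC
  set R := boundaryMatrix (c - deriv f b) b β with hR
  -- the three columns of approximate solutions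
  have hva : Continuous va := continuous_iff_continuousAt.2 fun x => (ha.dv x).continuousAt
  have hvE : Continuous vE := continuous_iff_continuousAt.2 fun x => (hE.dv x).continuousAt
  have hvs : Continuous vs := continuous_iff_continuousAt.2 fun x => (hs.dv x).continuousAt
  obtain ⟨wa, hwa⟩ : ∃ wa : ℝ → Fin 3 → ℂ, wa = fun x =>
    ![(va x : ℂ), ra x, (1 + 0 * u x + (c - deriv f (u x)) * va x : ℝ)] := ⟨_, rfl⟩
  obtain ⟨wE, hwE⟩ : ∃ wE : ℝ → Fin 3 → ℂ, wE = fun x =>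
    ![(vE x : ℂ), rE x, (0 + 0 * u x + (c - deriv f (u x)) * vE x : ℝ)] := ⟨_, rfl⟩
  obtain ⟨ws, hws⟩ : ∃ ws : ℂ → ℝ → Fin 3 → ℂ, ws = fun μ x =>
    ![(p x : ℂ), (a + c * u x - f (u x) : ℝ), ((c - deriv f (u x)) * p x : ℝ)]
    + μ • ![(vs x : ℂ), rs x, (0 + -1 * u x + (c - deriv f (u x)) * vs x : ℝ)] := ⟨_, rfl⟩
  have hsa := IsApproxSolution.of_isVariation hf hN ha
  have hsE := IsApproxSolution.of_isVariation hf hN hE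
  -- The residual μu_x of the translation mode cancels against μ·(-u_x) from the variation in s,
  -- leaving second order in μ.
  have hss : ∀ μ, IsApproxSolution f c u p μ (ws μ) (fun x => μ ^ 2 * vs x) := fun μ => by
    have h := (IsApproxSolution.of_isNewton hf hN μ).add_smul
      (IsApproxSolution.of_isVariation hf hN hs μ) μ
    have h2 : (fun x => μ ^ 2 * (vs x : ℂ))
        = fun x => μ * (p x : ℂ) + μ * (((-1 : ℝ) : ℂ) * p x + μ * vs x) := by
      ext x
      push_cast
      ring
    rw [h2, hws]
    exact h
  rw [← hwa] at hsa
  rw [← hwE] at hsE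
  -- Here n is the order of the residual in μ: 1 for the variations in a and E, 2 for the corrected
  -- translation mode.
  have column : ∀ (n : ℕ) (w : ℂ → ℝ → Fin 3 → ℂ) (ρ : ℂ → ℝ → ℂ) (g : ℝ → ℝ), Continuous g →
      (∀ μ, IsApproxSolution f c u p μ (w μ) (ρ μ)) → (∀ μ x, ρ μ x = μ ^ n * g x) →
      (fun q : ℂ × ℝ => R.mulVec ((Φ T q.1).mulVec (w q.1 0)) 0 - R.mulVec (w q.1 0) 0
        - q.1 * ∫ x in (0 : ℝ)..T, w q.1 x 0) =O[l] (fun q => r q ^ (n + 1)) ∧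
      (fun q : ℂ × ℝ => R.mulVec ((Φ T q.1).mulVec (w q.1 0)) 1 - R.mulVec (w q.1 0) 1
        - q.1 * ∫ x in (0 : ℝ)..T, (u x : ℂ) * w q.1 x 0) =O[l] (fun q => r q ^ (n + 1)) ∧
      (fun q : ℂ × ℝ => R.mulVec ((Φ T q.1).mulVec (w q.1 0)) 2 - w q.1 T 1)
        =O[l] (fun q => r q ^ n) := by
    intro n w ρ g hg hw hρ
    obtain ⟨B, hB⟩ := isCompact_Icc.exists_bound_of_continuousOn (s := Set.Icc 0 T)
      hg.continuousOn
    have hest := fun q : ℂ × ℝ => fun hq : ‖q.1‖ ≤ 1 =>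
      hC q.1 (w q.1) (ρ q.1) (‖q.1‖ ^ n * |B|) hq (by positivity) (hw q.1) (fun x hx => by
        rw [hρ, norm_mul, norm_pow, Complex.norm_real]
        exact mul_le_mul_of_nonneg_left ((hB x hx).trans (le_abs_self B)) (by positivity))
    have h1 : (fun q : ℂ × ℝ => ‖q.1‖ ^ n * |B|) =O[l] fun q => r q ^ n := by
      have := ((hμr.norm_left.pow n).const_mul_left |B|)
      exact this.congr_left fun q => by ring
    have h2 : (fun q : ℂ × ℝ => ‖q.1‖ * (‖q.1‖ ^ n * |B|)) =O[l] fun q => r q ^ (n + 1) := by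
      refine (hμr.norm_left.mul h1).congr_right fun q => by ring
    have big : ∀ {F : ℂ × ℝ → ℂ} {G : ℂ × ℝ → ℝ} {k : ℕ},
        (∀ q : ℂ × ℝ, ‖q.1‖ ≤ 1 → ‖F q‖ ≤ C * G q) → G =O[l] (fun q => r q ^ k) →
        F =O[l] fun q => r q ^ k := fun {F G k} hF hG => by
      refine IsBigO.trans ?_ (hG.const_mul_left C)
      refine IsBigO.of_bound 1 ?_
      filter_upwards [hμ1] with q hq
      rw [one_mul]
      exact (hF q hq).trans (le_abs_self _)
    exact ⟨big (fun q hq => (hest q hq).1) h2, big (fun q hq => (hest q hq).2.1) h2,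
      big (fun q hq => (hest q hq).2.2) h1⟩
  obtain ⟨ca0, ca1, ca2⟩ := column 1 (fun _ => wa) _ va hva hsa (fun μ x => by simp)
  obtain ⟨cE0, cE1, cE2⟩ := column 1 (fun _ => wE) _ vE hvE hsE (fun μ x => by simp)
  obtain ⟨cs0, cs1, cs2⟩ := column 2 ws _ vs hvs hss (fun μ x => rfl)
  -- initial values
  have hβC : (β : ℂ) ≠ 0 := Complex.ofReal_ne_zero.2 hβ0
  have Ra : R.mulVec (wa 0) = ![-1, 0, 0] := by
    ext i
    fin_cases i <;>
      (simp [hR, hwa, boundaryMatrix, Matrix.mulVec, dotProduct, Fin.sum_univ_three, ha0, ha.r0,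
        hN.u0]; try (field_simp; ring))
  have RE : R.mulVec (wE 0) = ![0, 1, 0] := by
    ext i
    fin_cases i <;>
      (simp [hR, hwE, boundaryMatrix, Matrix.mulVec, dotProduct, Fin.sum_univ_three, hE0, hE.r0,
        hN.u0]; try (field_simp; ring))
  have Rs : ∀ μ, R.mulVec (ws μ 0) = ![μ * b, μ * (b ^ 2 / 2), β] := fun μ => by
    have hβ' : (β : ℂ) = a + c * b - f b := by rw [hβ]; push_cast; ring
    ext i
    fin_cases i
    · simp [hR, hws, boundaryMatrix, Matrix.mulVec, dotProduct, Fin.sum_univ_three, hs0,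
        hN.u0, hN.p0]
      ring
    · simp [hR, hws, boundaryMatrix, Matrix.mulVec, dotProduct, Fin.sum_univ_three, hs0,
        hN.u0, hN.p0]
      field_simp
      ring
    · simp [hR, hws, boundaryMatrix, Matrix.mulVec, dotProduct, Fin.sum_univ_three, hs.r0,
        hN.u0, hβ']
  -- integrals
  have ofReal_int : ∀ F : ℝ → ℝ, ∫ x in (0 : ℝ)..T, (F x : ℂ) = ((∫ x in (0 : ℝ)..T, F x : ℝ) : ℂ) :=
    fun F => intervalIntegral.integral_ofReal
  have ia : ∫ x in (0 : ℝ)..T, wa x 0 = Ia := by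
    rw [← hIa, ← ofReal_int, hwa]; rfl
  have iE : ∫ x in (0 : ℝ)..T, wE x 0 = IE := by
    rw [← hIE, ← ofReal_int, hwE]; rfl
  have ja : ∫ x in (0 : ℝ)..T, (u x : ℂ) * wa x 0 = Ja := by
    rw [← hJa, ← ofReal_int]; simp [hwa]
  have jE : ∫ x in (0 : ℝ)..T, (u x : ℂ) * wE x 0 = JE := by
    rw [← hJE, ← ofReal_int]; simp [hwE]
  have ip : ∫ x in (0 : ℝ)..T, p x = 0 := by
    rw [intervalIntegral.integral_eq_sub_of_hasDerivAt (fun x _ => hN.du x)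
      (hN.continuous_p.intervalIntegrable _ _), huT, hN.u0, sub_self]
  have iup : ∫ x in (0 : ℝ)..T, u x * p x = 0 := by
    have hc : Continuous fun x => u x * p x := hN.continuous_u.mul hN.continuous_p
    rw [intervalIntegral.integral_eq_sub_of_hasDerivAt (f := fun x => u x ^ 2 / 2)
      (f' := fun x => u x * p x)
      (fun x _ => (((hN.du x).pow 2).div_const 2).congr_deriv (by push_cast; ring))
      (hc.intervalIntegrable _ _), huT, hN.u0, sub_self]
  have is : ∀ μ, ∫ x in (0 : ℝ)..T, ws μ x 0 = μ * Is := fun μ => by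
    have h1 : ∀ x, ws μ x 0 = (p x : ℂ) + μ * (vs x : ℂ) := fun x => by simp [hws]
    simp only [h1]
    rw [intervalIntegral.integral_add, intervalIntegral.integral_const_mul, ofReal_int, ofReal_int,
      ip, hIs, Complex.ofReal_zero, zero_add]
    · exact (Complex.continuous_ofReal.comp hN.continuous_p).intervalIntegrable _ _
    · exact ((Complex.continuous_ofReal.comp hvs).const_mul μ).intervalIntegrable _ _
  have js : ∀ μ, ∫ x in (0 : ℝ)..T, (u x : ℂ) * ws μ x 0 = μ * Js := fun μ => by
    have h1 : ∀ x, (u x : ℂ) * ws μ x 0 = ((u x * p x : ℝ) : ℂ) + μ * ((u x * vs x : ℝ) : ℂ) :=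
      fun x => by simp [hws]; ring
    simp only [h1]
    rw [intervalIntegral.integral_add, intervalIntegral.integral_const_mul, ofReal_int, ofReal_int,
      iup, hJs, Complex.ofReal_zero, zero_add]
    · exact (Complex.continuous_ofReal.comp
        (hN.continuous_u.mul hN.continuous_p)).intervalIntegrable _ _
    · exact ((Complex.continuous_ofReal.comp
        (hN.continuous_u.mul hvs)).const_mul μ).intervalIntegrable _ _
  have tE : wE T 1 = -TE * β := by simp [hwE, hET]
  have ta : wa T 1 = -Ta * β := by simp [hwa, haT]
  have ts : ∀ μ, ws μ T 1 = β + μ * (-Ts * β) := fun μ => by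
    simp [hws, hsT, huT, hβ]
  simp only [ia, iE, is, ja, jE, js, ta, tE, ts] at ca0 ca1 ca2 cE0 cE1 cE2 cs0 cs1 cs2
  simp only [Ra, RE, Rs] at ca0 ca1 ca2 cE0 cE1 cE2 cs0 cs1 cs2
  set e : ℂ × ℝ → ℂ := fun q => Complex.exp (Complex.I * q.2) with he
  -- the transformed matrix and its determinant
  let W : ℂ → Matrix (Fin 3) (Fin 3) ℂ := fun μ => (Matrix.of ![ws μ 0, wa 0, wE 0]).transpose
  let A : ℂ × ℝ → Matrix (Fin 3) (Fin 3) ℂ := fun q =>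
    R * (Φ T q.1 - e q • (1 : Matrix (Fin 3) (Fin 3) ℂ)) * W q.1
  have hA : ∀ q i j, A q i j = R.mulVec ((Φ T q.1).mulVec (fun k => W q.1 k j)) i
      - e q * R.mulVec (fun k => W q.1 k j) i := fun q i j => by
    have h1 : A q = R * (Φ T q.1 * W q.1) - e q • (R * W q.1) := by
      simp only [A, mul_sub, sub_mul, Matrix.mul_smul, Matrix.smul_mul, mul_one, Matrix.mul_assoc]
    rw [h1]
    rfl
  -- Since this determinant is nonzero and independent of μ, passing from the Evans function to det
  -- A costs only a constant factor.
  have hRW : ∀ μ, (R * W μ).det = -β := fun μ => by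
    have h1 : ∀ i j, (R * W μ) i j = R.mulVec (fun k => W μ k j) i := fun i j => rfl
    have h2 : ∀ i, (R * W μ) i 0 = ![μ * b, μ * (b ^ 2 / 2), (β : ℂ)] i := fun i => by
      rw [← Rs μ]; rfl
    have h3 : ∀ i, (R * W μ) i 1 = ![(-1 : ℂ), 0, 0] i := fun i => by
      rw [← Ra]; rfl
    have h4 : ∀ i, (R * W μ) i 2 = ![(0 : ℂ), 1, 0] i := fun i => by
      rw [← RE]; rfl
    rw [Matrix.det_fin_three]
    simp [h2, h3, h4]
  have hdet : ∀ q, evansFunction Φ T q.1 q.2 = (-1 / (β : ℂ)) * (A q).det := fun q => by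
    have h1 : (A q).det = evansFunction Φ T q.1 q.2 * (R * W q.1).det := by
      simp only [A, Matrix.det_mul, evansFunction, he]
      ring
    rw [h1, hRW]
    field_simp
  simp only [hdet, ← mul_sub]
  refine IsBigO.const_mul_left ?_ _
  refine IsBigO.trans ?_ (norm_add_abs_pow_four_isBigO l)
  have hA0 : ∀ q i, A q i 0 = R.mulVec ((Φ T q.1).mulVec (ws q.1 0)) i
      - e q * ![q.1 * b, q.1 * (b ^ 2 / 2), (β : ℂ)] i := fun q i => by
    rw [hA, ← Rs]; rfl
  have hA1 : ∀ q i, A q i 1 = R.mulVec ((Φ T q.1).mulVec (wa 0)) i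
      - e q * ![(-1 : ℂ), 0, 0] i := fun q i => by
    rw [hA, ← Ra]; rfl
  have hA2 : ∀ q i, A q i 2 = R.mulVec ((Φ T q.1).mulVec (wE 0)) i
      - e q * ![(0 : ℂ), 1, 0] i := fun q i => by
    rw [hA, ← RE]; rfl
  have hconst : ∀ k : ℂ, (fun _ : ℂ × ℝ => k) =O[l] fun q => r q ^ 0 := fun k => by
    simpa using isBigO_const_const k (one_ne_zero (α := ℝ)) l
  have hμμ : (fun q : ℂ × ℝ => q.1 ^ 2) =O[l] fun q => r q ^ 2 := hμr.pow 2
  have hσμ : (fun q : ℂ × ℝ => Complex.I * q.2 * q.1) =O[l] fun q => r q ^ 2 :=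
    (hσr.mul hμr).congr_right fun q => by ring
  have heμ : (fun q : ℂ × ℝ => (e q - 1 - Complex.I * q.2) * q.1) =O[l] fun q => r q ^ 3 :=
    (he2.mul hμr).congr_right fun q => by ring
  have hμr' : (fun q : ℂ × ℝ => q.1) =O[l] fun q => r q ^ 1 := by simpa using hμr
  have hσr' : (fun q : ℂ × ℝ => Complex.I * q.2) =O[l] fun q => r q ^ 1 := by simpa using hσr
  -- The two rows of conserved quantities vanish at the origin, and the translation column vanishes
  -- to one order more because ∫u_x = ∫u u_x = 0 and its initial functionals in these rows are O(μ).
  -- The weights add up to 3, so the error has order 4.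
  refine isBigO_det_sub hr1 ![1, 1, 0] ![1, 0, 0] (fun i j => ?_) (fun i j => ?_)
  · fin_cases i <;> fin_cases j
    · change (fun q => A q 0 0 - (q.1 ^ 2 * Is - Complex.I * q.2 * q.1 * b)) =O[l] fun q => r q ^ 3
      refine (cs0.sub (heμ.const_mul_left (b : ℂ))).congr_left fun q => ?_
      rw [hA0]
      simp
      ring
    · change (fun q => A q 0 1 - (q.1 * Ia + Complex.I * q.2)) =O[l] fun q => r q ^ 2
      refine (ca0.add he2).congr_left fun q => ?_
      rw [hA1]
      simp [he]
      ring
    · change (fun q => A q 0 2 - q.1 * IE) =O[l] fun q => r q ^ 2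
      refine cE0.congr_left fun q => ?_
      rw [hA2]
      simp
    · change (fun q => A q 1 0 - (q.1 ^ 2 * Js - Complex.I * q.2 * q.1 * b ^ 2 / 2))
        =O[l] fun q => r q ^ 3
      refine (cs1.sub (heμ.const_mul_left (b ^ 2 / 2 : ℂ))).congr_left fun q => ?_
      rw [hA0]
      simp
      ring
    · change (fun q => A q 1 1 - q.1 * Ja) =O[l] fun q => r q ^ 2
      refine ca1.congr_left fun q => ?_
      rw [hA1]
      simp
    · change (fun q => A q 1 2 - (q.1 * JE - Complex.I * q.2)) =O[l] fun q => r q ^ 2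
      refine (cE1.sub he2).congr_left fun q => ?_
      rw [hA2]
      simp [he]
      ring
    · change (fun q => A q 2 0 - (-q.1 * Ts * β - Complex.I * q.2 * β)) =O[l] fun q => r q ^ 2
      refine (cs2.sub (he2.const_mul_left (β : ℂ))).congr_left fun q => ?_
      rw [hA0]
      simp [he]
      ring
    · change (fun q => A q 2 1 - -Ta * β) =O[l] fun q => r q ^ 1
      refine ca2.congr_left fun q => ?_
      rw [hA1]
      simp
    · change (fun q => A q 2 2 - -TE * β) =O[l] fun q => r q ^ 1
      refine cE2.congr_left fun q => ?_
      rw [hA2]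
      simp
  · fin_cases i <;> fin_cases j
    · change (fun q : ℂ × ℝ => q.1 ^ 2 * (Is : ℂ) - Complex.I * q.2 * q.1 * b)
        =O[l] fun q => r q ^ 2
      exact ((hμμ.const_mul_left (Is : ℂ)).sub (hσμ.const_mul_left (b : ℂ))).congr_left
        fun q => by ring
    · change (fun q : ℂ × ℝ => q.1 * (Ia : ℂ) + Complex.I * q.2) =O[l] fun q => r q ^ 1
      exact ((hμr'.const_mul_left (Ia : ℂ)).add hσr').congr_left fun q => by ring
    · change (fun q : ℂ × ℝ => q.1 * (IE : ℂ)) =O[l] fun q => r q ^ 1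
      exact (hμr'.const_mul_left (IE : ℂ)).congr_left fun q => by ring
    · change (fun q : ℂ × ℝ => q.1 ^ 2 * (Js : ℂ) - Complex.I * q.2 * q.1 * b ^ 2 / 2)
        =O[l] fun q => r q ^ 2
      exact ((hμμ.const_mul_left (Js : ℂ)).sub (hσμ.const_mul_left (b ^ 2 / 2 : ℂ))).congr_left
        fun q => by ring
    · change (fun q : ℂ × ℝ => q.1 * (Ja : ℂ)) =O[l] fun q => r q ^ 1
      exact (hμr'.const_mul_left (Ja : ℂ)).congr_left fun q => by ring
    · change (fun q : ℂ × ℝ => q.1 * (JE : ℂ) - Complex.I * q.2) =O[l] fun q => r q ^ 1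
      exact ((hμr'.const_mul_left (JE : ℂ)).sub hσr').congr_left fun q => by ring
    · change (fun q : ℂ × ℝ => -q.1 * (Ts : ℂ) * β - Complex.I * q.2 * β) =O[l] fun q => r q ^ 1
      exact ((hμr'.const_mul_left (-Ts * β : ℂ)).sub (hσr'.const_mul_left (β : ℂ))).congr_left
        fun q => by ring
    · exact hconst _
    · exact hconst _

/-! ### The Whitham determinant. -/

/-- The characteristic determinant of the Whitham system at `s = 0`, in terms of the derivatives
of period, mass and momentum. -/
theorem whithamDet_neg {f : ℝ → ℝ} {m a E c : ℝ} {T' M' P' : Fin 3 → ℝ}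
    (hT0 : period f m a E c ≠ 0)
    (hT : ∀ j, HasDerivAt (fun t => period f m (a + t * (Pi.single j 1 : Fin 3 → ℝ) 0)
      (E + t * (Pi.single j 1 : Fin 3 → ℝ) 1) (c + t * -(Pi.single j 1 : Fin 3 → ℝ) 2)) (T' j) 0)
    (hM : ∀ j, HasDerivAt (fun t => mass f m (a + t * (Pi.single j 1 : Fin 3 → ℝ) 0)
      (E + t * (Pi.single j 1 : Fin 3 → ℝ) 1) (c + t * -(Pi.single j 1 : Fin 3 → ℝ) 2)) (M' j) 0)
    (hP : ∀ j, HasDerivAt (fun t => momentum f m (a + t * (Pi.single j 1 : Fin 3 → ℝ) 0)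
      (E + t * (Pi.single j 1 : Fin 3 → ℝ) 1) (c + t * -(Pi.single j 1 : Fin 3 → ℝ) 2)) (P' j) 0)
    (μ : ℂ) (κ : ℝ) :
    whithamDet f m c (-μ) κ a E 0 = 1 / (period f m a E c : ℂ) ^ 4 *
      (!![μ * M' 0 + Complex.I * κ, μ * M' 1, μ * M' 2;
        μ * P' 0, μ * P' 1 - 2 * (Complex.I * κ), μ * P' 2;
        μ * T' 0, μ * T' 1, μ * T' 2 + Complex.I * κ] : Matrix (Fin 3) (Fin 3) ℂ).det := by
  set q : Fin 3 → ℝ := ![a, E, 0] with hq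
  have hupd : ∀ (S : ℝ → ℝ → ℝ → ℝ) (j : Fin 3) (d : ℝ),
      HasDerivAt (fun t => S (a + t * (Pi.single j 1 : Fin 3 → ℝ) 0)
        (E + t * (Pi.single j 1 : Fin 3 → ℝ) 1) (c + t * -(Pi.single j 1 : Fin 3 → ℝ) 2)) d 0 →
      HasDerivAt (fun t => S (Function.update q j t 0) (Function.update q j t 1)
        (c - Function.update q j t 2)) d (q j) := by
    intro S j d h
    rw [← sub_self (q j)] at h
    have h2 := h.comp_sub_const (q j) (q j)
    refine h2.congr_of_eventuallyEq (Eventually.of_forall fun t => ?_)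
    have e : ∀ i, Function.update q j t i = q i + (t - q j) * (Pi.single j 1 : Fin 3 → ℝ) i :=
      fun i => by
        rcases eq_or_ne i j with rfl | hij
        · simp
        · simp [hij]
    simp only [e]
    simp [hq, sub_eq_add_neg]
  have hT1 := fun j => hupd _ j _ (hT j)
  have hM1 := fun j => hupd _ j _ (hM j)
  have hP1 := fun j => hupd _ j _ (hP j)
  have hc : ∀ j i, HasDerivAt (fun t => Function.update q j t i)
      ((Pi.single j 1 : Fin 3 → ℝ) i) (q j) := fun j i =>
    hasDerivAt_pi.1 (hasDerivAt_update q j (q j)) i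
  have hval : ∀ S : ℝ → ℝ → ℝ → ℝ, ∀ j, S (Function.update q j (q j) 0)
      (Function.update q j (q j) 1) (c - Function.update q j (q j) 2) = S a E c := fun S j => by
    rw [Function.update_eq_self]
    simp [hq]
  have hTv := hval (period f m)
  have hMv := hval (mass f m)
  have hPv := hval (momentum f m)
  set T := period f m a E c with hTdef
  set M := mass f m a E c
  set P := momentum f m a E c
  have hω : ∀ j, HasDerivAt (fun t => 1 / period f m (Function.update q j t 0)
      (Function.update q j t 1) (c - Function.update q j t 2)) (-T' j / T ^ 2) (q j) := fun j => by
    have := ((hasDerivAt_const (q j) (1 : ℝ)).div (hT1 j) (by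
      rw [hTv]; exact hT0))
    rw [hTv] at this
    exact this.congr_deriv (by ring)
  have hMω := fun j => (hM1 j).mul (hω j)
  have hPω := fun j => (hP1 j).mul (hω j)
  have hq2 : ∀ j, Function.update q j (q j) 2 = 0 := fun j => by
    rw [Function.update_eq_self]
    simp [hq]
  have hD : jacobianMatrix (whithamDensity f m c) q = Matrix.of
      ![fun j => M' j * (1 / T) + M * (-T' j / T ^ 2), fun j => P' j * (1 / T) + P * (-T' j / T ^ 2),
        fun j => -T' j / T ^ 2] := by
    ext i j
    fin_cases i
    · refine (hMω j).deriv.trans ?_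
      simp only [hTv, hMv]
      rfl
    · refine (hPω j).deriv.trans ?_
      simp only [hTv, hPv]
      rfl
    · exact (hω j).deriv
  -- At s = 0 the factor s kills every product-rule term in which M, P or ω is differentiated; only
  -- its own derivative survives, in the last column.
  have hF : jacobianMatrix (whithamFlux f m c) q = Matrix.of
      ![fun j => (Pi.single j 1 : Fin 3 → ℝ) 0 - (Pi.single j 1 : Fin 3 → ℝ) 2 * (M * (1 / T)),
        fun j => -(Pi.single j 1 : Fin 3 → ℝ) 2 * (P * (1 / T))
          - 2 * (Pi.single j 1 : Fin 3 → ℝ) 1,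
        fun j => -(Pi.single j 1 : Fin 3 → ℝ) 2 * (1 / T)] := by
    ext i j
    fin_cases i
    · refine ((hc j 0).sub (((hc j 2).mul (hM1 j)).mul (hω j))).deriv.trans ?_
      simp only [Pi.mul_apply, hTv, hMv]
      simp only [hq2]
      change _ = (Pi.single j 1 : Fin 3 → ℝ) 0 - (Pi.single j 1 : Fin 3 → ℝ) 2 * (M * (1 / T))
      ring
    · refine (((((hc j 2).neg).mul (hP1 j)).mul (hω j)).sub ((hc j 1).const_mul 2)).deriv.trans ?_
      simp only [Pi.mul_apply, Pi.neg_apply, hTv, hPv]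
      simp only [hq2]
      change _ = -(Pi.single j 1 : Fin 3 → ℝ) 2 * (P * (1 / T))
          - 2 * (Pi.single j 1 : Fin 3 → ℝ) 1
      ring
    · refine (((hc j 2).neg).mul (hω j)).deriv.trans ?_
      simp only [Pi.neg_apply, hTv]
      simp only [hq2]
      change _ = -(Pi.single j 1 : Fin 3 → ℝ) 2 * (1 / T)
      ring
  have hTC : (T : ℂ) ≠ 0 := Complex.ofReal_ne_zero.2 hT0
  -- The third row is 1/T² times the target row. The first two are -1/T times theirs plus M and P
  -- times the third row, so the overall factor is 1/T⁴.
  rw [whithamDet, hD, hF, sub_zero, ← hTdef, Matrix.det_fin_three, Matrix.det_fin_three]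
  simp
  field_simp
  ring

end GKdV

/-! ### Comparison of the two determinants. -/

theorem theorem2 (f : ℝ → ℝ) (hf : ContDiff ℝ 2 f)
    (a₀ E₀ c₀ um up m : ℝ)
    (hwell : GKdV.IsPotentialWell f a₀ E₀ c₀ um up) (hm : m ∈ Set.Ioo um up)
    (Φ : ℝ → ℂ → Matrix (Fin 3) (Fin 3) ℂ)
    (hΦ : GKdV.IsFundamentalMatrix
      (GKdV.systemMatrix f c₀ (GKdV.profile f m a₀ E₀ c₀)) Φ)
    (hTMP : GKdV.jacobianTMP f m a₀ E₀ c₀ ≠ 0)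
    (hcoord : GKdV.CoordinatizationNonsingular f m a₀ E₀ c₀) :
    ∃ Γ₀ : ℂ, Γ₀ ≠ 0 ∧
      (fun p : ℂ × ℝ =>
        GKdV.evansFunction Φ (GKdV.period f m a₀ E₀ c₀) p.1 p.2
          - Γ₀ * GKdV.whithamDet f m c₀ (-p.1) p.2 a₀ E₀ 0)
        =O[𝓝 ((0 : ℂ), (0 : ℝ))] fun p : ℂ × ℝ => ‖p.1‖ ^ 4 + p.2 ^ 4 := by
  obtain ⟨p, β, hβ, hβe, hN, hT, hpT, huT, hvar⟩ := GKdV.exists_wave_variation hf hwell hm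
  obtain ⟨va, ra, Ta, ha, ha0, haT, hTa, hMa, hPa⟩ := hvar 1 0 0
  obtain ⟨vE, rE, TE, hE, hE0, hET, hTE, hME, hPE⟩ := hvar 0 1 0
  -- The direction is negative because c = c₀ - s.
  obtain ⟨vs, rs, Ts, hs, hs0, hsT, hTs, hMs, hPs⟩ := hvar 0 0 (-1)
  set T := GKdV.period f m a₀ E₀ c₀ with hTdef
  set u := GKdV.profile f m a₀ E₀ c₀ with hu
  have htwo : ∀ v : ℝ → ℝ, ∫ x in (0 : ℝ)..T, 2 * u x * v x = 2 * ∫ x in (0 : ℝ)..T, u x * v x :=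
    fun v => by
      rw [← intervalIntegral.integral_const_mul]
      simp only [mul_assoc]
  rw [htwo] at hPa hPE hPs
  have hexp := GKdV.evansFunction_expansion hf hN hT huT hpT hβe hβ.ne' ha hE hs
    (by rw [ha0]; ring) (by rw [hE0]; ring) (by rw [hs0]; field_simp; ring)
    haT hET hsT hΦ rfl rfl rfl rfl rfl rfl
  have hTC : (T : ℂ) ≠ 0 := Complex.ofReal_ne_zero.2 hT.ne'
  have hβC : (β : ℂ) ≠ 0 := Complex.ofReal_ne_zero.2 hβ.ne'
  -- T⁴ undoes the normalization of `whithamDet_neg`; the 1/2 arises because the second row holds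
  -- ∫uv while P varies by 2∫uv. Subtracting μu₋/β and μu₋²/(2β) times the third row restores the
  -- boundary terms T'u₋ and T'u₋²/2. Shifting a factor μ from the translation column to the third
  -- row and permuting columns cyclically then matches the determinants.
  refine ⟨T ^ 4 / 2, div_ne_zero (pow_ne_zero 4 hTC) two_ne_zero, hexp.congr_left fun q => ?_⟩
  rw [GKdV.whithamDet_neg (T' := ![Ta, TE, Ts]) (M' := ![_, _, _]) (P' := ![_, _, _]) hT.ne'
    (fun j => by
      fin_cases j
      · simpa using hTa
      · simpa using hTE
      · simpa using hTs)
    (fun j => by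
      fin_cases j
      · simpa using hMa
      · simpa using hME
      · simpa using hMs)
    (fun j => by
      fin_cases j
      · simpa using hPa
      · simpa using hPE
      · simpa using hPs), ← hTdef, Matrix.det_fin_three, Matrix.det_fin_three]
  simp
  field_simp
  ring
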